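/- **Theorem 16.** All graphs are finite and simple. For a cycle $C$, a set $S\subseteq V(C)$ and vertices $x,y\in V(C)$, let $A$ and $B$ be the two (possibly empty) components of $C-\{x,y\}$ (if $x=y$, one of them is $C-x$ and the other is empty), and define the distance between $x$ and $y$ on $C$ with respect to $S$ as $$\mathrm{dist}_{(C,S)}(x,y)=\min\{|V(A)\cap S|,\ |V(B)\cap S|\}.$$ Let $G$ be a graph embedded in a cylinder, and suppose that $G$ has three pairwise disjoint homotopic cycles $C_1,C_2,C_3$ such that $C_1$ and $C_3$ coincide with the two cuffs (boundary components) of the cylinder. Let $k\ge 7$ be an integer and let $P_0,\dots,P_{k-1}$ be pairwise disjoint paths in $G$, where $P_i$ has one end $s_i$ on $C_1$ and the other end $t_i$ on $C_3$, such that for every $0\le i\le k-1$ and $1\le j\le 3$ the intersection of $P_i$ and $C_j$ is a single vertex. Set $S=\{s_0,\dots,s_{k-1}\}$ and $T=\{t_0,\dots,t_{k-1}\}$. Let $a_1,a_2\in V(C_1)$ and $b_1,b_2\in V(C_3)$ be such that $b_1\ne b_2$ and $\mathrm{dist}_{(C_1,S)}(a_1,a_2)\ge 2$. Then the following holds. (i)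 If $\mathrm{dist}_{(C_3,T)}(b_1,b_2)\ge 1$, then the graph $G+a_1b_1+a_2b_2$ contains $K_6$ as a minor. (ii) If $\mathrm{dist}_{(C_3,T)}(b_1,b_2)=0$, and $a_3\in V(C_1)$ and $b_3\in V(C_3)$ are vertices such that $\mathrm{dist}_{(C_3,T)}(b_1,b_3)\ge 1$ or $\mathrm{dist}_{(C_3,T)}(b_2,b_3)\ge 1$, then the graph $G+a_1b_1+a_2b_2+a_3b_3$ contains $K_6$ as a minor. -/

import Mathlib

/-- `H` is a minor of `G`: there are pairwise disjoint connected (in particular non-empty) branch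
sets in `G`, one for each vertex of `H`, with an edge of `G` between the branch sets of any two
adjacent vertices of `H`. -/
def SimpleGraph.IsMinorOf {W V : Type*} (H : SimpleGraph W) (G : SimpleGraph V) : Prop :=
  ∃ B : W → Set V,
    (∀ w, (G.induce (B w)).Connected) ∧
    (Pairwise fun w w' => Disjoint (B w) (B w')) ∧
    ∀ w w', H.Adj w w' → ∃ x ∈ B w, ∃ y ∈ B w', G.Adj x y

/-- The closed cylinder `S¹ × [0,1]`. -/
abbrev Cylinder : Type := Circle × unitInterval

/-- The cuff (boundary circle) of the cylinder at height `h`, for `h = 0` or `h = 1`. -/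
def Cylinder.cuff (h : unitInterval) : Set Cylinder := {p | p.2 = h}

/-- An embedding of the graph `G` in a topological space `X`: distinct vertices are distinct points,
every edge is a simple arc joining its ends, an arc contains no vertices except the ends of the edge,
and the arcs of two different edges have nothing but vertices in common. The arc of an edge
is parametrized from either end, the two parametrizations being reverse to each other. -/
structure GraphEmbedding {V : Type*} (G : SimpleGraph V) (X : Type*) [TopologicalSpace X] where
  point : V → X
  point_injective : Function.Injective point
  arc : ∀ {u v : V}, G.Adj u v → Path (point u) (point v)
  arc_symm : ∀ {u v : V} (h : G.Adj u v), arc h.symm = (arc h).symm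
  arc_injective : ∀ {u v : V} (h : G.Adj u v), Function.Injective (arc h)
  eq_end_of_arc_eq_point : ∀ {u v : V} (h : G.Adj u v) (r : unitInterval) (w : V),
    arc h r = point w → w = u ∨ w = v
  exists_point_of_arc_eq_arc : ∀ {u v u' v' : V} (h : G.Adj u v) (h' : G.Adj u' v')
    (r r' : unitInterval), s(u, v) ≠ s(u', v') → arc h r = arc h' r' → ∃ w, arc h r = point w

/-- The curve in `X` traced by a walk of the embedded graph. -/
noncomputable def GraphEmbedding.curve {V : Type*} {G : SimpleGraph V} {X : Type*}
    [TopologicalSpace X] (D : GraphEmbedding G X) :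
    ∀ {u v : V}, G.Walk u v → Path (D.point u) (D.point v)
  | _, _, .nil => Path.refl _
  | _, _, .cons h p => (D.arc h).trans (D.curve p)

/-- Free homotopy of closed curves (the base point may move). -/
def FreelyHomotopic {X : Type*} [TopologicalSpace X] {x y : X} (p : Path x x) (q : Path y y) :
    Prop :=
  ∃ H : C(unitInterval × unitInterval, X),
    (∀ r, H (0, r) = p r) ∧ (∀ r, H (1, r) = q r) ∧ ∀ a, H (a, 0) = H (a, 1)

/-- Two cycles of an embedded graph are homotopic: for a suitable choice of their
orientations, the closed curves that they trace are freely homotopic. -/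
def GraphEmbedding.HomotopicCycles {V : Type*} {G : SimpleGraph V} {X : Type*}
    [TopologicalSpace X] (D : GraphEmbedding G X) {u v : V} (C : G.Walk u u) (C' : G.Walk v v) :
    Prop :=
  FreelyHomotopic (D.curve C) (D.curve C') ∨ FreelyHomotopic (D.curve C) (D.curve C').symm

/-- For vertices `x, y` of a cycle `C`, the vertex set of the open segment of `C` from `x` to `y`
(in the direction in which `C` is traversed), without `x` and `y`. It is empty if `x = y`. -/
def segmentFrom {V : Type*} [DecidableEq V] {G : SimpleGraph V} {u : V} (C : G.Walk u u) (x y : V)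
    (hx : x ∈ C.support) (hy : y ∈ C.support) : Finset V :=
  ((C.rotate x hx).takeUntil y ((C.mem_support_rotate_iff x hx).2 hy)).support.toFinset \ {x, y}

/-- The vertex set of the complementary open segment of the cycle `C`, from `y` on to `x`,
without `x` and `y`. It consists of all vertices of `C` but `x` if `x = y`. -/
def segmentBack {V : Type*} [DecidableEq V] {G : SimpleGraph V} {u : V} (C : G.Walk u u) (x y : V)
    (hx : x ∈ C.support) (hy : y ∈ C.support) : Finset V :=
  ((C.rotate x hx).dropUntil y ((C.mem_support_rotate_iff x hx).2 hy)).support.toFinset \ {x, y}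

/-- The distance between the vertices `x` and `y` on the cycle `C` with respect to `S`: the smaller
of the numbers of elements of `S` in the two components (possibly empty) of `C - {x, y}`. -/
def cycleDist {V : Type*} [DecidableEq V] {G : SimpleGraph V} {u : V} (C : G.Walk u u)
    (S : Finset V) (x y : V) (hx : x ∈ C.support) (hy : y ∈ C.support) : ℕ :=
  min (segmentFrom C x y hx hy ∩ S).card (segmentBack C x y hx hy ∩ S).card

/-! ### Curves in a half plane -/

/-! Topology enters through one fact: disjoint paths starting on a cuff meet all three cycles in the
same cyclic order. The rest is counting labels modulo seven.

For the order, pass to the universal cover, inside the upper half plane with period `2π`. A cycle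
homotopic to a cuff turns exactly once (`turn`), so it lifts to a simple curve `g` with `g (t + 1) =
g t + 2π`, and every path lifts to curves from the real axis, each meeting `g` once at most. If two
of these met `g` in the wrong order, the left one could be continued along `g` to the far right and
the right one to the far left without a crossing. This contradicts `exists_crossing`, a winding
argument for the difference of two curves. The outcome is `meeting_param_lt` and, for cyclic orders,
`GraphEmbedding.exists_positions`.

For the counting, keep seven paths, among them those that witness the given distances. Their feet
mark each cycle, and the vertices of a cycle get monotone labels modulo 7 in which the foot of path
`i` has label `i`; a vertex strictly between two feet may take either neighbouring label. Split `C₁`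
into an arc `A` of three labels and an arc `A'` of four, split `C₃` likewise into `B` and `B'` with
`B` moved by two labels against `A`, and split `C₂` into three arcs, each taken together with the
interiors of the paths through it. If one added edge joins `A` to `B` and another joins `A'` to
`B'`, then `A ∪ B`, `A'`, `B'` and the three middle pieces are the branch sets of a `K₆`
(`Frame.isMinorOf_of_arcs`).

Distance at least 2 on `C₁` allows labels for `a₁, a₂` that differ by 3 or 4, and distance at least
1 on `C₃` allows labels for `b₁, b₂` that differ by 2 to 5; a finite check then finds suitable arcs.
In case (ii), `b₁, b₂` get consecutive labels and `b₃` a different one, and the check shows that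
some two of the three edges are suitable, whatever the label of `a₃`. -/

lemma Complex.exists_continuous_log {X : Type*} [TopologicalSpace X] [SimplyConnectedSpace X]
    [LocallyPathConnectedSpace X] {F : X → ℂ} (hF : Continuous F) (h0 : ∀ x, F x ≠ 0) :
    ∃ L : X → ℂ, Continuous L ∧ ∀ x, Complex.exp (L x) = F x := by
  obtain ⟨x₀⟩ : Nonempty X := inferInstance
  obtain ⟨L, ⟨-, hL⟩, -⟩ := Complex.isCoveringMapOn_exp.existsUnique_continuousMap_lifts
    ⟨F, hF⟩ (Complex.exp_log (h0 x₀)) h0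
  exact ⟨L, L.continuous, congrFun hL⟩

/-- A continuous function on `[0, M]` that never takes the value `c` stays on one side of `c`. -/
lemma lt_of_forall_ne_of_continuous {θ : ℝ → ℝ} (hθ : Continuous θ) {M c : ℝ} (hM : 0 ≤ M)
    (h0 : θ 0 < c) (hne : ∀ t ∈ Set.Icc 0 M, θ t ≠ c) : θ M < c := by
  by_contra! h
  obtain ⟨t, ht, htc⟩ := intermediate_value_Icc hM hθ.continuousOn ⟨h0.le, h⟩
  exact hne t ht htc

lemma gt_of_forall_ne_of_continuous {θ : ℝ → ℝ} (hθ : Continuous θ) {M c : ℝ} (hM : 0 ≤ M)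
    (h0 : c < θ 0) (hne : ∀ t ∈ Set.Icc 0 M, θ t ≠ c) : c < θ M := by
  have := lt_of_forall_ne_of_continuous hθ.neg hM (c := -c) (by simpa using h0)
    (fun t ht h => hne t ht (neg_injective h))
  simpa using this

/-- Two curves in the closed upper half plane that start on the real axis, the first one to the left
of the second, and of which the first one ends to the right of the second curve and the second one
ends to the left of the first curve, must cross. -/
theorem exists_crossing {f g : ℝ → ℂ} (hf : Continuous f) (hg : Continuous g) {M : ℝ} (hM : 0 ≤ M)
    (hf0 : (f 0).im = 0) (hg0 : (g 0).im = 0) (hfg : (f 0).re < (g 0).re)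
    (hfi : ∀ s, 0 ≤ (f s).im) (hgi : ∀ t, 0 ≤ (g t).im)
    (hfM : ∀ t ∈ Set.Icc 0 M, (g t).re < (f M).re)
    (hgM : ∀ s ∈ Set.Icc 0 M, (g M).re < (f s).re) : ∃ s t, f s = g t := by
  -- For disjoint curves `f s - g t` has a continuous argument `θ` on the whole parameter plane. At
  -- the origin it is an odd multiple of `π`, and the two ways round the square to `(M, M)` bring it
  -- to opposite sides of that value.
  by_contra! hne
  obtain ⟨L, hL, hexp⟩ := Complex.exists_continuous_log (X := ℝ × ℝ)
    (F := fun p => f p.1 - g p.2) (by fun_prop) (fun p => sub_ne_zero.2 (hne _ _))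
  set θ : ℝ → ℝ → ℝ := fun s t => (L (s, t)).im with hθ
  have hre : ∀ s t, (f s).re - (g t).re = Real.exp (L (s, t)).re * Real.cos (θ s t) := by
    intro s t
    have := congrArg Complex.re (hexp (s, t))
    simpa [Complex.exp_re] using this.symm
  have him : ∀ s t, (f s).im - (g t).im = Real.exp (L (s, t)).re * Real.sin (θ s t) := by
    intro s t
    have := congrArg Complex.im (hexp (s, t))
    simpa [Complex.exp_im] using this.symm
  have hcos : ∀ s t, (g t).re < (f s).re → 0 < Real.cos (θ s t) := fun s t h =>
    pos_of_mul_pos_right (by rw [← hre]; linarith) (Real.exp_pos _).le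
  have hsin1 : ∀ s, 0 ≤ Real.sin (θ s 0) := fun s => by
    by_contra! h
    have := mul_neg_of_pos_of_neg (Real.exp_pos (L (s, 0)).re) h
    rw [← him] at this
    have := hfi s
    linarith
  have hsin0 : ∀ t, Real.sin (θ 0 t) ≤ 0 := fun t => by
    by_contra! h
    have := mul_pos (Real.exp_pos (L (0, t)).re) h
    rw [← him] at this
    have := hgi t
    linarith
  obtain ⟨n, hn⟩ := Real.sin_eq_zero_iff.1 (le_antisymm (hsin0 0) (hsin1 0))
  have hcos0 : Real.cos (θ 0 0) < 0 := by
    by_contra! h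
    have := mul_nonneg (Real.exp_pos (L (0, 0)).re).le h
    rw [← hre] at this
    linarith
  -- `n` is odd
  obtain ⟨m, hm⟩ : ∃ m : ℤ, n = 2 * m + 1 := by
    rcases Int.even_or_odd n with h | h
    · exfalso
      obtain ⟨m, rfl⟩ := h
      have : Real.cos (θ 0 0) = 1 := by
        rw [← hn, show ((m + m : ℤ) : ℝ) * Real.pi = m * (2 * Real.pi) by push_cast; ring]
        exact Real.cos_int_mul_two_pi m
      linarith
    · exact h
  have h00 : θ 0 0 = Real.pi + m * (2 * Real.pi) := by rw [← hn, hm]; push_cast; ring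
  have hc0 : Continuous fun t => θ 0 t := by fun_prop
  have hc0' : Continuous fun s => θ s 0 := by fun_prop
  have hc1 : Continuous fun t => θ M t := by fun_prop
  have hc1' : Continuous fun s => θ s M := by fun_prop
  have hpi := Real.pi_pos
  -- Along `s = 0` the difference stays in the closed lower half plane, so `θ` cannot fall to `π /
  -- 2`. At `t = M` the cosine is positive, which excludes the values from there up to `π` (all
  -- modulo the fixed multiple of `2π`).
  have key0 : Real.pi + m * (2 * Real.pi) < θ 0 M := by
    have h1 : Real.pi / 2 + m * (2 * Real.pi) < θ 0 M := by
      refine gt_of_forall_ne_of_continuous hc0 hM (by rw [h00]; linarith) fun t _ ht => ?_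
      have := hsin0 t
      rw [ht, Real.sin_add_int_mul_two_pi, Real.sin_pi_div_two] at this
      linarith
    by_contra! h2
    have := hcos 0 M (hgM 0 ⟨le_rfl, hM⟩)
    rw [← Real.cos_sub_int_mul_two_pi _ m] at this
    exact absurd this (not_lt.2 (Real.cos_nonpos_of_pi_div_two_le_of_le (by linarith) (by linarith)))
  have key1 : θ M 0 < Real.pi + m * (2 * Real.pi) := by
    have h1 : θ M 0 < Real.pi + Real.pi / 2 + m * (2 * Real.pi) := by
      refine lt_of_forall_ne_of_continuous hc0' hM (by rw [h00]; linarith) fun t _ ht => ?_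
      have := hsin1 t
      rw [ht, Real.sin_add_int_mul_two_pi, add_comm, Real.sin_add_pi, Real.sin_pi_div_two] at this
      linarith
    by_contra! h2
    have := hcos M 0 (hfM 0 ⟨le_rfl, hM⟩)
    rw [← Real.cos_sub_int_mul_two_pi _ m] at this
    exact absurd this (not_lt.2 (Real.cos_nonpos_of_pi_div_two_le_of_le (by linarith) (by linarith)))
  -- On the two far sides of the square the difference has positive real part, so `θ` cannot cross
  -- this value there.
  have hnopi : ∀ s t, (g t).re < (f s).re → θ s t ≠ Real.pi + m * (2 * Real.pi) := by
    intro s t h ht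
    have := hcos s t h
    rw [ht, Real.cos_add_int_mul_two_pi, Real.cos_pi] at this
    linarith
  have h1 := gt_of_forall_ne_of_continuous hc1' hM key0 fun s hs => hnopi s M (hgM s hs)
  have h2 := lt_of_forall_ne_of_continuous hc1 hM key1 fun t ht => hnopi M t (hfM t ht)
  exact lt_asymm h1 h2

/-- Let `g` be a simple curve in the upper half plane that is invariant under translation by `2π`,
and let `f₁` and `f₂` be disjoint curves that start on the real axis and meet `g` only in `g μ₁` and
`g μ₂`. If `f₁` starts to the left of `f₂`, then `μ₁ < μ₂`. -/
theorem meeting_param_lt {g f₁ f₂ : ℝ → ℂ} (hg : Continuous g) (hginj : Function.Injective g)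
    (hper : ∀ t, g (t + 1) = g t + 2 * Real.pi) (hgi : ∀ t, 0 ≤ (g t).im)
    (hf₁ : Continuous f₁) (hf₂ : Continuous f₂) (h₁i : ∀ s, 0 ≤ (f₁ s).im)
    (h₂i : ∀ s, 0 ≤ (f₂ s).im) (h₁0 : (f₁ 0).im = 0) (h₂0 : (f₂ 0).im = 0)
    (hdisj : ∀ s ∈ Set.Icc (0 : ℝ) 1, ∀ t ∈ Set.Icc (0 : ℝ) 1, f₁ s ≠ f₂ t)
    {τ₁ τ₂ μ₁ μ₂ : ℝ} (hτ₁ : τ₁ ∈ Set.Icc (0 : ℝ) 1) (hτ₂ : τ₂ ∈ Set.Icc (0 : ℝ) 1)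
    (hμ₁ : f₁ τ₁ = g μ₁) (hμ₂ : f₂ τ₂ = g μ₂)
    (hu₁ : ∀ s ∈ Set.Icc (0 : ℝ) 1, ∀ t, f₁ s = g t → t = μ₁)
    (hu₂ : ∀ s ∈ Set.Icc (0 : ℝ) 1, ∀ t, f₂ s = g t → t = μ₂)
    (hlt : (f₁ 0).re < (f₂ 0).re) : μ₁ < μ₂ := by
  -- In the wrong order, let `A` follow `f₁` as far as `g` and then `g` forwards, and `B` follow
  -- `f₂` and then `g` backwards. The two pieces of `g` are disjoint, hence so are `A` and `B`,
  -- although `A` starts on the left and runs off to the right.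
  by_contra! hle
  have hne : μ₂ < μ₁ := lt_of_le_of_ne hle fun h => hdisj τ₁ hτ₁ τ₂ hτ₂ (by rw [hμ₁, hμ₂, h])
  -- `g` stays within bounded distance of the translation
  obtain ⟨K, hK⟩ : ∃ K, ∀ t, |(g t).re - 2 * Real.pi * t| ≤ K := by
    have hp : Function.Periodic (fun t => (g t).re - 2 * Real.pi * t) 1 := by
      intro t
      simp [hper]
      ring
    obtain ⟨K, hK⟩ := (isCompact_Icc (a := (0 : ℝ)) (b := 1)).exists_bound_of_continuousOn
      (f := fun t => (g t).re - 2 * Real.pi * t) (by fun_prop)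
    refine ⟨K, fun t => ?_⟩
    have h := hK (Int.fract t) ⟨Int.fract_nonneg t, (Int.fract_lt_one t).le⟩
    have h2 := hp.sub_int_mul_eq (x := t) ⌊t⌋
    simp only [mul_one] at h2
    rw [Int.fract] at h
    simp only [Real.norm_eq_abs] at h
    rwa [h2] at h
  obtain ⟨K₁, hK₁⟩ := (isCompact_Icc (a := (0 : ℝ)) (b := 1)).exists_bound_of_continuousOn
      (f := fun t => (f₁ t).re) (by fun_prop)
  obtain ⟨K₂, hK₂⟩ := (isCompact_Icc (a := (0 : ℝ)) (b := 1)).exists_bound_of_continuousOn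
      (f := fun t => (f₂ t).re) (by fun_prop)
  simp only [Real.norm_eq_abs] at hK₁ hK₂
  -- A crossing may occur at any real parameters, while the paths are controlled on `[0, 1]` only:
  -- `max s 0` keeps the curve at its starting point for negative `s`.
  set A : ℝ → ℂ := fun s => if s ≤ τ₁ then f₁ (max s 0) else g (μ₁ + (s - τ₁)) with hA
  set B : ℝ → ℂ := fun s => if s ≤ τ₂ then f₂ (max s 0) else g (μ₂ - (s - τ₂)) with hB
  have hAc : Continuous A := by
    refine Continuous.if_le (by fun_prop) (by fun_prop) continuous_id continuous_const ?_
    rintro s rfl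
    simp [max_eq_left hτ₁.1, hμ₁]
  have hBc : Continuous B := by
    refine Continuous.if_le (by fun_prop) (by fun_prop) continuous_id continuous_const ?_
    rintro s rfl
    simp [max_eq_left hτ₂.1, hμ₂]
  have hA' : ∀ s, (∃ r ∈ Set.Icc (0 : ℝ) 1, A s = f₁ r) ∨ ∃ r, μ₁ < r ∧ A s = g r := by
    intro s
    by_cases h : s ≤ τ₁
    · exact .inl ⟨max s 0, ⟨le_max_right _ _, max_le (h.trans hτ₁.2) zero_le_one⟩, if_pos h⟩
    · exact .inr ⟨_, by linarith, if_neg h⟩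
  have hB' : ∀ s, (∃ r ∈ Set.Icc (0 : ℝ) 1, B s = f₂ r) ∨ ∃ r, r < μ₂ ∧ B s = g r := by
    intro s
    by_cases h : s ≤ τ₂
    · exact .inl ⟨max s 0, ⟨le_max_right _ _, max_le (h.trans hτ₂.2) zero_le_one⟩, if_pos h⟩
    · exact .inr ⟨_, by linarith, if_neg h⟩
  have hpi := Real.pi_pos
  have hAlb : ∀ s, - |K₁| - |K| - 2 * Real.pi * |μ₁| ≤ (A s).re := by
    intro s
    have e1 := abs_nonneg K₁
    have e2 := abs_nonneg K
    have e3 : 0 ≤ 2 * Real.pi * |μ₁| := by positivity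
    rcases hA' s with ⟨r, hr, h⟩ | ⟨r, hr, h⟩
    · have := abs_le.1 (hK₁ r hr)
      have := le_abs_self K₁
      rw [h]; linarith
    · have h1 := abs_le.1 (hK r)
      have := le_abs_self K
      have h2 : 2 * Real.pi * (- |μ₁|) ≤ 2 * Real.pi * r :=
        mul_le_mul_of_nonneg_left (by linarith [neg_abs_le μ₁]) (by positivity)
      rw [h]; linarith
  have hBub : ∀ s, (B s).re ≤ |K₂| + |K| + 2 * Real.pi * |μ₂| := by
    intro s
    have e1 := abs_nonneg K₂
    have e2 := abs_nonneg K
    have e3 : 0 ≤ 2 * Real.pi * |μ₂| := by positivity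
    rcases hB' s with ⟨r, hr, h⟩ | ⟨r, hr, h⟩
    · have := abs_le.1 (hK₂ r hr)
      have := le_abs_self K₂
      rw [h]; linarith
    · have h1 := abs_le.1 (hK r)
      have := le_abs_self K
      have h2 : 2 * Real.pi * r ≤ 2 * Real.pi * |μ₂| :=
        mul_le_mul_of_nonneg_left (by linarith [le_abs_self μ₂]) (by positivity)
      rw [h]; linarith
  set R := |K₁| + |K₂| + 2 * |K| + 2 * Real.pi * |μ₁| + 2 * Real.pi * |μ₂| with hR
  have hR0 : 0 ≤ R := by positivity
  -- Each curve reaches `g` by time 1, so at time `M` it has run on `g` for at least `M - 1` units,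
  -- advancing `2π` per unit up to the error `K`. This exceeds `R`, the sum of all bounds.
  set M : ℝ := 2 + R with hM
  have hMR : R < 2 * Real.pi * (M - 1) := by
    have : 1 * (M - 1) ≤ 2 * Real.pi * (M - 1) :=
      mul_le_mul_of_nonneg_right (by linarith [Real.two_le_pi]) (by linarith)
    linarith
  have hAM : (A M).re > |K₂| + |K| + 2 * Real.pi * |μ₂| := by
    have h : A M = g (μ₁ + (M - τ₁)) := if_neg (by have := hτ₁.2; linarith)
    have h1 := abs_le.1 (hK (μ₁ + (M - τ₁)))
    have h2 : 2 * Real.pi * (- |μ₁| + (M - 1)) ≤ 2 * Real.pi * (μ₁ + (M - τ₁)) :=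
      mul_le_mul_of_nonneg_left (by linarith [neg_abs_le μ₁, hτ₁.2]) (by positivity)
    have := le_abs_self K
    have := abs_nonneg K₁
    rw [h]; linarith
  have hBM : (B M).re < - |K₁| - |K| - 2 * Real.pi * |μ₁| := by
    have h : B M = g (μ₂ - (M - τ₂)) := if_neg (by have := hτ₂.2; linarith)
    have h1 := abs_le.1 (hK (μ₂ - (M - τ₂)))
    have h2 : 2 * Real.pi * (μ₂ - (M - τ₂)) ≤ 2 * Real.pi * (|μ₂| - (M - 1)) :=
      mul_le_mul_of_nonneg_left (by linarith [le_abs_self μ₂, hτ₂.2]) (by positivity)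
    have := le_abs_self K
    have := abs_nonneg K₂
    rw [h]; linarith
  have hA0 : A 0 = f₁ 0 := by simp [hA, hτ₁.1]
  have hB0 : B 0 = f₂ 0 := by simp [hB, hτ₂.1]
  obtain ⟨s, t, hst⟩ := exists_crossing hAc hBc (M := M) (by linarith) (by rw [hA0, h₁0])
    (by rw [hB0, h₂0]) (by rwa [hA0, hB0])
    (fun s => by rcases hA' s with ⟨r, -, h⟩ | ⟨r, -, h⟩ <;> rw [h] <;> simp [h₁i, hgi])
    (fun s => by rcases hB' s with ⟨r, -, h⟩ | ⟨r, -, h⟩ <;> rw [h] <;> simp [h₂i, hgi])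
    (fun t _ => (hBub t).trans_lt hAM) (fun s _ => hBM.trans_le (hAlb s))
  rcases hA' s with ⟨r, hr, h⟩ | ⟨r, hr, h⟩ <;> rcases hB' t with ⟨r', hr', h'⟩ | ⟨r', hr', h'⟩ <;>
    rw [h, h'] at hst
  · exact hdisj r hr r' hr' hst
  · have := hu₁ r hr r' hst; linarith
  · have := hu₂ r' hr' r hst.symm; linarith
  · have := hginj hst; linarith

/-! ### Lifting curves in the cylinder -/

lemma Circle.exists_continuous_lift {X : Type*} [TopologicalSpace X] [SimplyConnectedSpace X]
    [LocallyPathConnectedSpace X] {F : X → Circle} (hF : Continuous F) :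
    ∃ L : X → ℝ, Continuous L ∧ ∀ x, Circle.exp (L x) = F x := by
  obtain ⟨x₀⟩ : Nonempty X := inferInstance
  obtain ⟨L, ⟨-, hL⟩, -⟩ := Circle.isCoveringMap_exp.existsUnique_continuousMap_lifts
    ⟨F, hF⟩ x₀ (Complex.arg (F x₀)) (Circle.exp_arg _)
  exact ⟨L, L.continuous, congrFun hL⟩

lemma Circle.exp_eq_exp_iff {x y : ℝ} :
    Circle.exp x = Circle.exp y ↔ ∃ n : ℤ, x = y + n * (2 * Real.pi) :=
  Circle.exp_eq_exp

namespace Path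

variable {X : Type*} [TopologicalSpace X] {x y z : X}

/-- The first half of the unit interval. -/
noncomputable def firstHalf (t : unitInterval) : unitInterval :=
  ⟨t / 2, by linarith [t.2.1], by linarith [t.2.2]⟩

/-- The second half of the unit interval. -/
noncomputable def secondHalf (t : unitInterval) : unitInterval :=
  ⟨(1 + t) / 2, by linarith [t.2.1], by linarith [t.2.2]⟩

lemma trans_firstHalf (p : Path x y) (q : Path y z) (t : unitInterval) :
    p.trans q (firstHalf t) = p t := by
  rw [Path.trans_apply, dif_pos (by simpa [firstHalf] using by linarith [t.2.2])]
  congr 1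
  ext
  simp only [firstHalf]
  ring

lemma trans_secondHalf (p : Path x y) (q : Path y z) (t : unitInterval) :
    p.trans q (secondHalf t) = q t := by
  rw [Path.trans_apply]
  split_ifs with h
  · obtain rfl : t = 0 := Subtype.ext (le_antisymm
      (by simp only [secondHalf] at h; simp only [Set.Icc.coe_zero]; linarith) t.2.1)
    rw [q.source]
    convert! p.target using 2
    ext
    simp [secondHalf]
  · congr 1
    ext
    simp only [secondHalf]
    ring

lemma eq_firstHalf_or_eq_secondHalf (t : unitInterval) :
    (∃ r, t = firstHalf r) ∨ ∃ r, t = secondHalf r := by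
  rcases le_total (t : ℝ) (1 / 2) with h | h
  · exact .inl ⟨⟨2 * t, by linarith [t.2.1], by linarith⟩, by ext; simp [firstHalf]⟩
  · exact .inr ⟨⟨2 * t - 1, by linarith, by linarith [t.2.2]⟩, by ext; simp [secondHalf]⟩

end Path

namespace Cylinder

variable {x y z : Cylinder}

/-- `L` is an angle function along the path `p`. -/
structure IsAngle (p : Path x y) (L : ℝ → ℝ) : Prop where
  cont : Continuous L
  exp_eq : ∀ t : unitInterval, Circle.exp (L t) = (p t).1

lemma exists_isAngle (p : Path x y) : ∃ L, IsAngle p L := by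
  obtain ⟨L, hL, h⟩ := Circle.exists_continuous_lift (F := fun t : ℝ => (p.extend t).1)
    (by fun_prop)
  exact ⟨L, hL, fun t => by simp [h]⟩

lemma IsAngle.add_const {p : Path x y} {L : ℝ → ℝ} (h : IsAngle p L) (n : ℤ) :
    IsAngle p fun t => L t + n * (2 * Real.pi) :=
  ⟨by have := h.cont; fun_prop, fun t => by
    rw [← h.exp_eq t]; exact Circle.exp_eq_exp_iff.2 ⟨n, rfl⟩⟩

lemma exists_isAngle_of_exp_eq (p : Path x y) {a : ℝ} (ha : Circle.exp a = x.1) :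
    ∃ L, IsAngle p L ∧ L 0 = a := by
  obtain ⟨L, hL⟩ := exists_isAngle p
  have h0 := hL.exp_eq 0
  rw [p.source, ← ha] at h0
  obtain ⟨n, hn⟩ := Circle.exp_eq_exp_iff.1 h0.symm
  exact ⟨_, hL.add_const n, hn.symm⟩

/-- By uniqueness of lifts, two angle functions differ by a constant. This makes `turn` independent
of the choice in its definition. -/
lemma IsAngle.sub_eq_sub {p : Path x y} {L L' : ℝ → ℝ} (h : IsAngle p L) (h' : IsAngle p L') :
    L 1 - L 0 = L' 1 - L' 0 := by
  have h0 := h.exp_eq 0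
  rw [← h'.exp_eq 0] at h0
  obtain ⟨n, hn⟩ := Circle.exp_eq_exp_iff.1 h0
  have h'' := h'.add_const n
  have c1 := h.cont
  have c2 := h'.cont
  have := Circle.isCoveringMap_exp.eq_of_comp_eq
    (g₁ := fun t : unitInterval => L t) (g₂ := fun t : unitInterval => L' t + n * (2 * Real.pi))
    (by fun_prop) (by fun_prop)
    (funext fun t => (h.exp_eq t).trans (h''.exp_eq t).symm) 0 hn
  have := congrFun this 1
  simp only [Set.Icc.coe_zero, Set.Icc.coe_one] at this hn
  linarith

/-- The total angle through which a path in the cylinder turns. -/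
noncomputable def turn (p : Path x y) : ℝ := (exists_isAngle p).choose 1 - (exists_isAngle p).choose 0

lemma IsAngle.turn_eq {p : Path x y} {L : ℝ → ℝ} (h : IsAngle p L) : turn p = L 1 - L 0 :=
  (exists_isAngle p).choose_spec.sub_eq_sub h

@[simp] lemma turn_refl : turn (Path.refl x) = 0 := by
  have : IsAngle (Path.refl x) fun _ => Complex.arg x.1 :=
    ⟨continuous_const, fun t => by simp⟩
  simp [this.turn_eq]

lemma turn_trans (p : Path x y) (q : Path y z) : turn (p.trans q) = turn p + turn q := by
  obtain ⟨L, hL⟩ := exists_isAngle (p.trans q)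
  have c := hL.cont
  have h1 : IsAngle p fun t => L (t / 2) := ⟨by fun_prop, fun t => by
    rw [← Path.trans_firstHalf p q t]; exact hL.exp_eq (Path.firstHalf t)⟩
  have h2 : IsAngle q fun t => L ((1 + t) / 2) := ⟨by fun_prop, fun t => by
    rw [← Path.trans_secondHalf p q t]; exact hL.exp_eq (Path.secondHalf t)⟩
  rw [hL.turn_eq, h1.turn_eq, h2.turn_eq]
  norm_num

lemma turn_symm (p : Path x y) : turn p.symm = - turn p := by
  obtain ⟨L, hL⟩ := exists_isAngle p
  have c := hL.cont
  have h1 : IsAngle p.symm fun t => L (1 - t) := ⟨by fun_prop, fun t => hL.exp_eq (unitInterval.symm t)⟩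
  rw [hL.turn_eq, h1.turn_eq]
  norm_num

lemma turn_eq_int_mul (p : Path x x) : ∃ n : ℤ, turn p = n * (2 * Real.pi) := by
  obtain ⟨L, hL⟩ := exists_isAngle p
  have h : Circle.exp (L 1) = Circle.exp (L 0) := by
    have h0 := hL.exp_eq 0
    have h1 := hL.exp_eq 1
    rw [p.source] at h0
    rw [p.target] at h1
    simp only [Set.Icc.coe_zero, Set.Icc.coe_one] at h0 h1
    rw [h0, h1]
  obtain ⟨n, hn⟩ := Circle.exp_eq_exp_iff.1 h
  exact ⟨n, by rw [hL.turn_eq]; linarith⟩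

/-- Lift the whole homotopy to the line. The lifts of its two closing sides differ by a multiple of
`2π`, and uniqueness of lifts makes this multiple constant during the homotopy. -/
lemma turn_eq_of_freelyHomotopic {p : Path x x} {q : Path y y} (h : FreelyHomotopic p q) :
    turn p = turn q := by
  obtain ⟨H, h0, h1, hs⟩ := h
  obtain ⟨L, hL, hexp⟩ := Circle.exists_continuous_lift (X := ℝ × ℝ)
    (F := fun a => (H (Set.projIcc 0 1 zero_le_one a.1, Set.projIcc 0 1 zero_le_one a.2)).1)
    (by fun_prop)
  have hp : IsAngle p fun t => L (0, t) := ⟨by fun_prop, fun t => by simp [hexp, h0]⟩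
  have hq : IsAngle q fun t => L (1, t) := ⟨by fun_prop, fun t => by simp [hexp, h1]⟩
  rw [hp.turn_eq, hq.turn_eq]
  have hl : ∀ a, Circle.exp (L (a, 1)) = Circle.exp (L (a, 0)) := fun a => by
    simp [hexp, hs]
  obtain ⟨n, hn⟩ := Circle.exp_eq_exp_iff.1 (hl 0)
  have := Circle.isCoveringMap_exp.eq_of_comp_eq
    (g₁ := fun t : ℝ => L (t, 1)) (g₂ := fun t : ℝ => L (t, 0) + n * (2 * Real.pi))
    (by fun_prop) (by fun_prop)
    (funext fun t => (hl t).trans (Circle.exp_eq_exp_iff.2 ⟨-n, by push_cast; ring⟩)) 0 hn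
  have := congrFun this 1
  linarith

/-- A closed curve in a cuff without multiple points goes around once. -/
lemma abs_turn_eq_of_injOn (p : Path x x) {h : unitInterval} (hp : ∀ t, (p t).2 = h)
    (hinj : Set.InjOn p (Set.Ico 0 1)) : turn p = 2 * Real.pi ∨ turn p = - (2 * Real.pi) := by
  obtain ⟨L, hL⟩ := exists_isAngle p
  obtain ⟨n, hn⟩ := turn_eq_int_mul p
  have c := hL.cont
  have hpi := Real.pi_pos
  have hinj' : ∀ s ∈ Set.Ico (0 : ℝ) 1, ∀ t ∈ Set.Ico (0 : ℝ) 1, ∀ m : ℤ,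
      L s = L t + m * (2 * Real.pi) → s = t := by
    intro s hs t ht m hst
    have hpe : p ⟨s, hs.1, hs.2.le⟩ = p ⟨t, ht.1, ht.2.le⟩ := Prod.ext (by
      rw [← hL.exp_eq, ← hL.exp_eq]; exact Circle.exp_eq_exp_iff.2 ⟨m, hst⟩) (by rw [hp, hp])
    have := hinj ⟨hs.1, hs.2⟩ ⟨ht.1, ht.2⟩ hpe
    exact congrArg Subtype.val this
  have hL1 : L 1 = L 0 + n * (2 * Real.pi) := by rw [← hn, hL.turn_eq]; ring
  have hnot : ∀ m : ℤ, ∀ t ∈ Set.Ioo (0 : ℝ) 1, L t ≠ L 0 + m * (2 * Real.pi) := fun m t ht h =>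
    ht.1.ne' (hinj' t ⟨ht.1.le, ht.2⟩ 0 (by simp) m h)
  rcases lt_trichotomy n 0 with h | rfl | h
  · rcases (show n ≤ -1 by omega).lt_or_eq with h1 | h1
    · exfalso
      have h1' : (n : ℝ) < -1 := by exact_mod_cast h1
      -- More than one turn would bring the curve back to its starting point before the end.
      obtain ⟨t, ht, hLt⟩ := intermediate_value_Ioo' zero_le_one c.continuousOn
        (show L 0 + ((-1 : ℤ) : ℝ) * (2 * Real.pi) ∈ Set.Ioo (L 1) (L 0) by
          constructor
          · rw [hL1]; push_cast; nlinarith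
          · push_cast; linarith)
      exact hnot _ t ht hLt
    · right; rw [hn, h1]; push_cast; ring
  · exfalso
    simp only [Int.cast_zero, zero_mul, add_zero] at hL1
    -- Without any turn the angle goes from `L 0` to `L (1 / 2)` and back, so it takes the mean of
    -- these values in both halves.
    have hne : L (1 / 2) ≠ L 0 := by simpa using hnot 0 (1 / 2) (by norm_num)
    have huniq : ∀ s ∈ Set.Ioo (0 : ℝ) (1 / 2), ∀ t ∈ Set.Ioo (1 / 2 : ℝ) 1, L s ≠ L t := by
      intro s hs t ht hst
      have := hinj' s ⟨hs.1.le, by linarith [hs.2]⟩ t ⟨by linarith [ht.1], ht.2⟩ 0 (by simpa using hst)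
      linarith [hs.2, ht.1]
    rcases hne.lt_or_gt with h | h
    · obtain ⟨s, hs, hLs⟩ := intermediate_value_Ioo' (show (0 : ℝ) ≤ 1 / 2 by norm_num) c.continuousOn
        (show (L 0 + L (1 / 2)) / 2 ∈ Set.Ioo (L (1 / 2)) (L 0) by constructor <;> linarith)
      obtain ⟨t, ht, hLt⟩ := intermediate_value_Ioo (show (1 / 2 : ℝ) ≤ 1 by norm_num) c.continuousOn
        (show (L 0 + L (1 / 2)) / 2 ∈ Set.Ioo (L (1 / 2)) (L 1) by constructor <;> linarith)
      exact huniq s hs t ht (hLs.trans hLt.symm)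
    · obtain ⟨s, hs, hLs⟩ := intermediate_value_Ioo (show (0 : ℝ) ≤ 1 / 2 by norm_num) c.continuousOn
        (show (L 0 + L (1 / 2)) / 2 ∈ Set.Ioo (L 0) (L (1 / 2)) by constructor <;> linarith)
      obtain ⟨t, ht, hLt⟩ := intermediate_value_Ioo' (show (1 / 2 : ℝ) ≤ 1 by norm_num) c.continuousOn
        (show (L 0 + L (1 / 2)) / 2 ∈ Set.Ioo (L 1) (L (1 / 2)) by constructor <;> linarith)
      exact huniq s hs t ht (hLs.trans hLt.symm)
  · rcases (show 1 ≤ n by omega).lt_or_eq with h1 | h1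
    · exfalso
      have h1' : (1 : ℝ) < n := by exact_mod_cast h1
      obtain ⟨t, ht, hLt⟩ := intermediate_value_Ioo zero_le_one c.continuousOn
        (show L 0 + ((1 : ℤ) : ℝ) * (2 * Real.pi) ∈ Set.Ioo (L 0) (L 1) by
          constructor
          · push_cast; linarith
          · rw [hL1]; push_cast; nlinarith)
      exact hnot _ t ht hLt
    · left; rw [hn, ← h1]; push_cast; ring

end Cylinder

/-! ### Curves of walks in an embedded graph -/

namespace Path

variable {X : Type*} [TopologicalSpace X] {x y z : X}

lemma secondHalf_lt_iff {s t : unitInterval} : secondHalf s < secondHalf t ↔ s < t := by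
  rw [← Subtype.coe_lt_coe, ← Subtype.coe_lt_coe]
  simp only [secondHalf]
  constructor <;> intro h <;> linarith

lemma firstHalf_one : firstHalf 1 = secondHalf 0 := by
  ext; simp [firstHalf, secondHalf]

lemma secondHalf_one : secondHalf 1 = 1 := by
  ext; simp [secondHalf]

lemma secondHalf_pos (t : unitInterval) : 0 < secondHalf t := by
  rw [← Subtype.coe_lt_coe]
  simp only [secondHalf, Set.Icc.coe_zero]
  linarith [t.2.1]

lemma trans_injective {p : Path x y} {q : Path y z} (hp : Function.Injective p)
    (hq : Function.Injective q) (h : ∀ s t, p s = q t → p s = y) :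
    Function.Injective (p.trans q) := by
  have mixed : ∀ r r', p r = q r' → firstHalf r = secondHalf r' := by
    intro r r' e
    have h1 := h r r' e
    obtain rfl : r = 1 := hp (h1.trans p.target.symm)
    obtain rfl : r' = 0 := hq (by rw [← e, h1, q.source])
    exact firstHalf_one
  intro s t hst
  rcases eq_firstHalf_or_eq_secondHalf s with ⟨r, rfl⟩ | ⟨r, rfl⟩ <;>
    rcases eq_firstHalf_or_eq_secondHalf t with ⟨r', rfl⟩ | ⟨r', rfl⟩ <;>
    simp only [trans_firstHalf, trans_secondHalf] at hst
  · rw [hp hst]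
  · exact mixed _ _ hst
  · exact (mixed _ _ hst.symm).symm
  · rw [hq hst]

lemma trans_injOn_Ico {p : Path x y} {q : Path y x} (hp : Function.Injective p)
    (hq : Function.Injective q) (h : ∀ s t, p s = q t → p s = x ∨ p s = y) :
    Set.InjOn (p.trans q) (Set.Ico 0 1) := by
  have mixed : ∀ r r', p r = q r' → secondHalf r' < 1 → firstHalf r = secondHalf r' := by
    intro r r' e hr
    rcases h r r' e with h1 | h1
    · obtain rfl : r' = 1 := hq (by rw [← e, h1, q.target])
      rw [secondHalf_one] at hr
      exact absurd hr (lt_irrefl _)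
    · obtain rfl : r = 1 := hp (h1.trans p.target.symm)
      obtain rfl : r' = 0 := hq (by rw [← e, h1, q.source])
      exact firstHalf_one
  intro s hs t ht hst
  rcases eq_firstHalf_or_eq_secondHalf s with ⟨r, rfl⟩ | ⟨r, rfl⟩ <;>
    rcases eq_firstHalf_or_eq_secondHalf t with ⟨r', rfl⟩ | ⟨r', rfl⟩ <;>
    simp only [trans_firstHalf, trans_secondHalf] at hst
  · rw [hp hst]
  · exact mixed _ _ hst ht.2
  · exact (mixed _ _ hst.symm hs.2).symm
  · rw [hq hst]

end Path

namespace GraphEmbedding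

variable {V : Type*} {G : SimpleGraph V} {X : Type*} [TopologicalSpace X] (D : GraphEmbedding G X)

/-- The curve traced by a walk with at least one edge, parametrized without a stationary part. -/
noncomputable def simpleCurve : ∀ {u v w : V}, G.Adj u v → G.Walk v w →
    Path (D.point u) (D.point w)
  | _, _, _, h, .nil => D.arc h
  | _, _, _, h, .cons h' p => (D.arc h).trans (simpleCurve h' p)

lemma range_simpleCurve : ∀ {u v w : V} (h : G.Adj u v) (p : G.Walk v w),
    Set.range (D.simpleCurve h p) = Set.range (D.curve (.cons h p))
  | _, v, _, h, .nil => by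
    rw [curve, Path.trans_range, curve, simpleCurve]
    simp only [Path.refl_range, Set.union_singleton]
    exact (Set.insert_eq_of_mem (show D.point v ∈ Set.range (D.arc h) from
      ⟨1, (D.arc h).target⟩)).symm
  | _, _, _, h, .cons h' p => by
    rw [curve, Path.trans_range, simpleCurve, Path.trans_range, range_simpleCurve h' p]

lemma point_mem_range_curve : ∀ {u v : V} (p : G.Walk u v) {w : V}, w ∈ p.support →
    D.point w ∈ Set.range (D.curve p)
  | _, _, .nil, w, hw => by
    simp only [SimpleGraph.Walk.support_nil, List.mem_singleton] at hw
    subst hw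
    exact ⟨0, (D.curve .nil).source⟩
  | u, _, .cons h p, w, hw => by
    rw [curve, Path.trans_range]
    rcases List.mem_cons.1 hw with rfl | hw
    · exact .inl ⟨0, (D.arc h).source⟩
    · exact .inr (point_mem_range_curve p hw)

lemma exists_dart_of_mem_range_curve : ∀ {u v : V} (p : G.Walk u v) {x : X},
    x ∈ Set.range (D.curve p) →
    x = D.point v ∨ ∃ d ∈ p.darts, x ∈ Set.range (D.arc d.adj)
  | _, _, .nil, x, hx => by
    simp only [curve, Path.refl_range, Set.mem_singleton_iff] at hx
    exact .inl hx
  | u, _, .cons h p, x, hx => by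
    rw [curve, Path.trans_range] at hx
    rcases hx with hx | hx
    · exact .inr ⟨⟨(_, _), h⟩, by simp, hx⟩
    · rcases exists_dart_of_mem_range_curve p hx with h' | ⟨d, hd, h'⟩
      · exact .inl h'
      · exact .inr ⟨d, by simp [hd], h'⟩

/-- The curves of two walks without a common edge meet only in common vertices. -/
lemma exists_common_vertex {u v u' v' : V} (p : G.Walk u v) (q : G.Walk u' v')
    (hpq : ∀ e ∈ p.edges, e ∉ q.edges) {x : X} (hp : x ∈ Set.range (D.curve p))
    (hq : x ∈ Set.range (D.curve q)) :
    ∃ w, w ∈ p.support ∧ w ∈ q.support ∧ x = D.point w := by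
  have hend : ∀ {a b : V} (r : G.Walk a b) (d : G.Dart), d ∈ r.darts → ∀ w,
      D.point w ∈ Set.range (D.arc d.adj) → w ∈ r.support := by
    rintro a b r d hd w ⟨t, ht⟩
    rcases D.eq_end_of_arc_eq_point d.adj t w ht with rfl | rfl
    · exact r.dart_fst_mem_support_of_mem_darts hd
    · exact r.dart_snd_mem_support_of_mem_darts hd
  rcases D.exists_dart_of_mem_range_curve p hp with rfl | ⟨d, hd, hdx⟩
  · rcases D.exists_dart_of_mem_range_curve q hq with h' | ⟨d', hd', hdx'⟩
    · exact ⟨v, p.end_mem_support, by rw [D.point_injective h']; exact q.end_mem_support, rfl⟩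
    · exact ⟨v, p.end_mem_support, hend q d' hd' _ hdx', rfl⟩
  · rcases D.exists_dart_of_mem_range_curve q hq with rfl | ⟨d', hd', hdx'⟩
    · exact ⟨v', hend p d hd _ hdx, q.end_mem_support, rfl⟩
    · obtain ⟨t, ht⟩ := hdx
      obtain ⟨t', ht'⟩ := hdx'
      obtain ⟨w, hw⟩ := D.exists_point_of_arc_eq_arc d.adj d'.adj t t'
        (fun e => hpq d.edge (List.mem_map_of_mem hd)
          (by rw [show d.edge = d'.edge from e]; exact List.mem_map_of_mem hd'))
        (ht.trans ht'.symm)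
      rw [ht] at hw
      subst hw
      exact ⟨w, hend p d hd _ ⟨t, ht⟩, hend q d' hd' _ ⟨t', ht'⟩, rfl⟩

lemma edges_disjoint_of_support {u v u' v' : V} (p : G.Walk u v) (q : G.Walk u' v')
    (h : ∀ a b, a ∈ p.support → a ∈ q.support → b ∈ p.support → b ∈ q.support → a = b) :
    ∀ e ∈ p.edges, e ∉ q.edges := by
  intro e
  induction e using Sym2.ind with
  | _ a b =>
    intro hp hq
    exact (p.adj_of_mem_edges hp).ne (h a b (p.fst_mem_support_of_mem_edges hp)
      (q.fst_mem_support_of_mem_edges hq) (p.snd_mem_support_of_mem_edges hp)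
      (q.snd_mem_support_of_mem_edges hq))

lemma mem_range_curve_of_arc {u v : V} (h : G.Adj u v) {x : X} (hx : x ∈ Set.range (D.arc h)) :
    x ∈ Set.range (D.curve (.cons h .nil)) := by
  rwa [← range_simpleCurve, simpleCurve]

lemma simpleCurve_injective : ∀ {u v w : V} (h : G.Adj u v) (p : G.Walk v w),
    (SimpleGraph.Walk.cons h p).IsPath → Function.Injective (D.simpleCurve h p)
  | _, _, _, h, .nil, _ => D.arc_injective h
  | u, v, _, h, .cons h' p, hp => by
    rw [SimpleGraph.Walk.cons_isPath_iff] at hp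
    refine Path.trans_injective (D.arc_injective h) (simpleCurve_injective h' p hp.1) ?_
    intro s t hst
    obtain ⟨w, hw, hw', hx⟩ := D.exists_common_vertex (.cons h .nil) (.cons h' p)
      (by
        intro e he he'
        simp only [SimpleGraph.Walk.edges_cons, SimpleGraph.Walk.edges_nil,
          List.mem_singleton] at he
        subst he
        exact hp.2 (SimpleGraph.Walk.fst_mem_support_of_mem_edges _ he'))
      (D.mem_range_curve_of_arc h ⟨s, rfl⟩)
      (by rw [← range_simpleCurve]; exact ⟨t, hst.symm⟩)
    simp only [SimpleGraph.Walk.support_cons, SimpleGraph.Walk.support_nil, List.mem_cons,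
      List.not_mem_nil, or_false] at hw
    rcases hw with rfl | rfl
    · exact absurd hw' hp.2
    · exact hx

lemma simpleCurve_injOn_Ico {u v : V} (h : G.Adj u v) (p : G.Walk v u)
    (hp : (SimpleGraph.Walk.cons h p).IsCycle) : Set.InjOn (D.simpleCurve h p) (Set.Ico 0 1) := by
  rw [SimpleGraph.Walk.cons_isCycle_iff] at hp
  cases p with
  | nil => exact absurd rfl h.ne
  | cons h' p =>
    refine Path.trans_injOn_Ico (D.arc_injective h) (D.simpleCurve_injective h' p hp.1) ?_
    intro s t hst
    obtain ⟨w, hw, -, hx⟩ := D.exists_common_vertex (.cons h .nil) (.cons h' p)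
      (by
        intro e he he'
        simp only [SimpleGraph.Walk.edges_cons, SimpleGraph.Walk.edges_nil,
          List.mem_singleton] at he
        subst he
        exact hp.2 he')
      (D.mem_range_curve_of_arc h ⟨s, rfl⟩)
      (by rw [← range_simpleCurve]; exact ⟨t, hst.symm⟩)
    simp only [SimpleGraph.Walk.support_cons, SimpleGraph.Walk.support_nil, List.mem_cons,
      List.not_mem_nil, or_false] at hw
    rcases hw with rfl | rfl
    · exact .inl hx
    · exact .inr hx

/-- The times at which the curve of a walk visits the vertices of the walk. -/
lemma exists_vertex_times : ∀ {u v w : V} (h : G.Adj u v) (p : G.Walk v w),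
    ∃ τ : ℕ → unitInterval, τ 0 = 0 ∧ τ (p.length + 1) = 1 ∧
      (∀ i j, i < j → j ≤ p.length + 1 → τ i < τ j) ∧
      ∀ i ≤ p.length + 1, D.simpleCurve h p (τ i) =
        D.point ((SimpleGraph.Walk.cons h p).getVert i)
  | u, v, _, h, .nil => by
    refine ⟨fun i => if i = 0 then 0 else 1, by simp, by simp, ?_, ?_⟩
    · intro i j hij hj
      obtain ⟨rfl, rfl⟩ : i = 0 ∧ j = 1 := by simp at hj; omega
      simp
    · intro i hi
      simp only [SimpleGraph.Walk.length_nil, zero_add] at hi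
      interval_cases i
      · simp
      · simp
  | u, v, w, h, .cons h' p => by
    obtain ⟨τ, h0, h1, hlt, hpt⟩ := exists_vertex_times h' p
    refine ⟨fun i => if i = 0 then 0 else Path.secondHalf (τ (i - 1)), by simp, ?_, ?_, ?_⟩
    · simp [h1, Path.secondHalf_one]
    · intro i j hij hj
      rw [SimpleGraph.Walk.length_cons] at hj
      simp only [show j ≠ 0 by omega, if_false]
      split_ifs with hi
      · exact Path.secondHalf_pos _
      · exact Path.secondHalf_lt_iff.2 (hlt _ _ (by omega) (by omega))
    · intro i hi
      rw [SimpleGraph.Walk.length_cons] at hi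
      cases i with
      | zero => simp
      | succ i =>
        simp only [Nat.add_eq_zero_iff, one_ne_zero, and_false, if_false, Nat.add_sub_cancel]
        rw [simpleCurve, Path.trans_secondHalf, hpt i (by omega)]
        rfl

/-! ### Turning of walks in the cylinder. -/

variable (E : GraphEmbedding G Cylinder)

open Cylinder

lemma turn_simpleCurve : ∀ {u v w : V} (h : G.Adj u v) (p : G.Walk v w),
    turn (E.simpleCurve h p) = turn (E.curve (.cons h p))
  | _, _, _, h, .nil => by simp [curve, turn_trans, simpleCurve]
  | _, _, _, h, .cons h' p => by
    rw [curve, turn_trans, simpleCurve, turn_trans, turn_simpleCurve h' p]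

lemma turn_curve_eq_sum : ∀ {u v : V} (p : G.Walk u v),
    turn (E.curve p) = (p.darts.map fun d => turn (E.arc d.adj)).sum
  | _, _, .nil => by simp [curve]
  | _, _, .cons h p => by
    rw [curve, turn_trans, turn_curve_eq_sum p]
    simp

/-- The curve of the reversed walk is parametrized differently from the reversed curve, so the turns
are compared edge by edge. -/
lemma turn_curve_reverse {u v : V} (p : G.Walk u v) :
    turn (E.curve p.reverse) = - turn (E.curve p) := by
  rw [turn_curve_eq_sum, turn_curve_eq_sum, SimpleGraph.Walk.darts_reverse, List.map_reverse,
    List.sum_reverse, List.map_map]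
  induction p.darts with
  | nil => simp
  | cons d l ih =>
    simp only [List.map_cons, List.sum_cons, ih, neg_add, Function.comp]
    congr 1
    rw [← turn_symm, ← E.arc_symm]
    rfl

end GraphEmbedding

/-! ### The order in which disjoint paths meet an essential cycle -/

namespace Cylinder

/-- The point `z` of the upper half plane lies over the point `p` of the cylinder in the universal
cover. -/
def LiesOver (z : ℂ) (p : Cylinder) : Prop := Circle.exp z.re = p.1 ∧ z.im = p.2

lemma LiesOver.unique {z : ℂ} {p q : Cylinder} (hp : LiesOver z p) (hq : LiesOver z q) : p = q :=
  Prod.ext (hp.1.symm.trans hq.1) (Subtype.ext (hp.2.symm.trans hq.2))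

lemma LiesOver.exists_eq_add {z w : ℂ} {p : Cylinder} (hz : LiesOver z p) (hw : LiesOver w p) :
    ∃ n : ℤ, z = w + n * (2 * Real.pi) := by
  obtain ⟨n, hn⟩ := Circle.exp_eq_exp_iff.1 (hz.1.trans hw.1.symm)
  refine ⟨n, Complex.ext ?_ ?_⟩
  · simpa using hn
  · simpa using hz.2.trans hw.2.symm

lemma LiesOver.add {z : ℂ} {p : Cylinder} (hz : LiesOver z p) (n : ℤ) :
    LiesOver (z + n * (2 * Real.pi)) p :=
  ⟨by rw [← hz.1]; exact Circle.exp_eq_exp_iff.2 ⟨n, by simp⟩, by rw [← hz.2]; simp⟩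

variable {x y : Cylinder}

lemma exists_path_lift (p : Path x y) {a : ℝ} (ha : Circle.exp a = x.1) :
    ∃ f : ℝ → ℂ, Continuous f ∧ (∀ t, 0 ≤ (f t).im) ∧ (f 0).re = a ∧
      ∀ t : unitInterval, LiesOver (f t) (p t) := by
  obtain ⟨L, hL, h0⟩ := exists_isAngle_of_exp_eq p ha
  have c := hL.cont
  refine ⟨fun t => ⟨L t, (p.extend t).2⟩, ?_, fun t => (p.extend t).2.2.1, h0, fun t =>
    ⟨hL.exp_eq t, by simp⟩⟩
  have : (fun t : ℝ => (⟨L t, (p.extend t).2⟩ : ℂ)) =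
      fun t => (L t : ℂ) + ((p.extend t).2 : ℝ) * Complex.I := by
    funext t
    apply Complex.ext <;> simp
  rw [this]
  fun_prop

/-- Subtracting the drift `2π t` from a lift over one period leaves a function with equal values at
both ends, which extends periodically. As the loop is simple, equal values of `g` force equal
fractional parts, and then the real part forces equal integer parts. -/
lemma exists_loop_lift (p : Path x x) (hp : turn p = 2 * Real.pi)
    (hinj : Set.InjOn p (Set.Ico 0 1)) :
    ∃ g : ℝ → ℂ, Continuous g ∧ Function.Injective g ∧ (∀ t, g (t + 1) = g t + 2 * Real.pi) ∧
      ∀ t, LiesOver (g t) (p ⟨Int.fract t, Int.fract_nonneg t, (Int.fract_lt_one t).le⟩) := by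
  obtain ⟨f, hf, -, -, hfp⟩ := exists_path_lift p (Circle.exp_arg x.1)
  have hf1 : f 1 = f 0 + 2 * Real.pi := by
    have h : IsAngle p fun t => (f t).re := ⟨by fun_prop, fun t => (hfp t).1⟩
    have h0 := (hfp 0).2
    have h1 := (hfp 1).2
    have := h.turn_eq
    rw [p.source] at h0
    rw [p.target, ← h0] at h1
    simp only [Set.Icc.coe_zero, Set.Icc.coe_one] at h1
    apply Complex.ext
    · simp
      linarith
    · simpa using h1
  set F : ℝ → ℂ := fun t => f t - t * (2 * Real.pi) with hF
  have hg : ∀ t : ℝ, F (Int.fract t) + t * (2 * Real.pi) =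
      f (Int.fract t) + (⌊t⌋ : ℤ) * (2 * Real.pi) := by
    intro t
    have : (t : ℂ) = (Int.fract t : ℝ) + (⌊t⌋ : ℤ) := by
      exact_mod_cast (Int.fract_add_floor t).symm
    simp only [hF]
    linear_combination (2 * Real.pi : ℂ) * this
  have hover : ∀ t, LiesOver (F (Int.fract t) + t * (2 * Real.pi))
      (p ⟨Int.fract t, Int.fract_nonneg t, (Int.fract_lt_one t).le⟩) := by
    intro t
    rw [hg]
    exact (hfp ⟨Int.fract t, _⟩).add _
  refine ⟨fun t => F (Int.fract t) + t * (2 * Real.pi), ?_, ?_, ?_, hover⟩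
  · have : Continuous fun t => F (Int.fract t) :=
      ContinuousOn.comp_fract'' (f := F) (by fun_prop) (by simp [hF, hf1])
    exact this.add (by fun_prop)
  · intro t t' htt
    simp only at htt
    have h1 := hover t
    rw [htt] at h1
    have h2 := hinj ⟨Int.fract_nonneg t, Int.fract_lt_one t⟩
      ⟨Int.fract_nonneg t', Int.fract_lt_one t'⟩ (h1.unique (hover t'))
    have h3 : Int.fract t = Int.fract t' := congrArg Subtype.val h2
    rw [hg, hg, h3] at htt
    have h4 := congrArg Complex.re (add_left_cancel htt)
    have h5 : ((⌊t⌋ : ℤ) : ℝ) = (⌊t'⌋ : ℤ) := by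
      have := Real.pi_ne_zero
      simpa [this] using h4
    rw [← Int.fract_add_floor t, ← Int.fract_add_floor t', h3, h5]
  · intro t
    simp only [Int.fract_add_one]
    push_cast
    ring

end Cylinder

/-- The vertices of a closed walk, indexed cyclically by the integers. -/
def SimpleGraph.Walk.cyclicVert {V : Type*} {G : SimpleGraph V} {u : V} (C : G.Walk u u)
    (r : ℤ) : V :=
  C.getVert (r % C.length).toNat

namespace GraphEmbedding

open Cylinder

variable {V : Type*} {G : SimpleGraph V} (D : GraphEmbedding G Cylinder)

lemma exists_lift_of_isPath {u v : V} (p : G.Walk u v) (hp : p.IsPath) (huv : u ≠ v) {a : ℝ}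
    (ha : Circle.exp a = (D.point u).1) :
    ∃ f : ℝ → ℂ, Continuous f ∧ (∀ t, 0 ≤ (f t).im) ∧ (f 0).re = a ∧ LiesOver (f 0) (D.point u) ∧
      (∀ t ∈ Set.Icc (0 : ℝ) 1, ∃ y ∈ Set.range (D.curve p), LiesOver (f t) y) ∧
      (∀ y ∈ Set.range (D.curve p), ∃ t ∈ Set.Icc (0 : ℝ) 1, LiesOver (f t) y) ∧
      ∀ s ∈ Set.Icc (0 : ℝ) 1, ∀ t ∈ Set.Icc (0 : ℝ) 1, ∀ y, LiesOver (f s) y →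
        LiesOver (f t) y → s = t := by
  cases p with
  | nil => exact absurd rfl huv
  | cons h p =>
    obtain ⟨f, hf, hfi, hfa, hfo⟩ := exists_path_lift (D.simpleCurve h p) ha
    refine ⟨f, hf, hfi, hfa, ?_, ?_, ?_, ?_⟩
    · have := hfo 0
      rwa [Path.source] at this
    · intro t ht
      exact ⟨_, by rw [← range_simpleCurve]; exact ⟨⟨t, ht⟩, rfl⟩, hfo ⟨t, ht⟩⟩
    · intro y hy
      rw [← range_simpleCurve] at hy
      obtain ⟨t, rfl⟩ := hy
      exact ⟨t, t.2, hfo t⟩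
    · intro s hs t ht y h1 h2
      have e1 := h1.unique (hfo ⟨s, hs⟩)
      have e2 := h2.unique (hfo ⟨t, ht⟩)
      exact congrArg Subtype.val (D.simpleCurve_injective h p hp (e1.symm.trans e2))

/-- `T` gives the times at which the lifted cycle visits its vertices. For the index `r`, the
quotient by the length counts full turns and the remainder determines the time within a turn. -/
lemma exists_lift_of_isCycle {u : V} (C : G.Walk u u) (hC : C.IsCycle)
    (hturn : turn (D.curve C) = 2 * Real.pi) :
    ∃ g : ℝ → ℂ, Continuous g ∧ Function.Injective g ∧ (∀ t, g (t + 1) = g t + 2 * Real.pi) ∧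
      (∀ t, ∃ y ∈ Set.range (D.curve C), LiesOver (g t) y) ∧
      ∃ T : ℤ → ℝ, StrictMono T ∧ (∀ r n : ℤ, T (r + n * C.length) = T r + n) ∧
        ∀ r, LiesOver (g (T r)) (D.point (C.cyclicVert r)) := by
  cases C with
  | nil => exact absurd rfl hC.ne_nil
  | cons h p =>
    rw [← turn_simpleCurve] at hturn
    obtain ⟨g, hg, hinj, hper, hover⟩ := exists_loop_lift _ hturn (D.simpleCurve_injOn_Ico h p hC)
    refine ⟨g, hg, hinj, hper, fun t => ⟨_, ?_, hover t⟩, ?_⟩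
    · rw [← range_simpleCurve]; exact ⟨_, rfl⟩
    obtain ⟨τ, h0, h1, hlt, hpt⟩ := D.exists_vertex_times h p
    set N : ℕ := p.length + 1 with hN
    have hlen : (SimpleGraph.Walk.cons h p).length = N := SimpleGraph.Walk.length_cons h p
    have hNpos : (0 : ℤ) < N := by omega
    have hmod : ∀ r : ℤ, (r % N).toNat < N := fun r => by
      have := Int.emod_lt_of_pos r hNpos
      have := Int.emod_nonneg r hNpos.ne'
      omega
    have hτ1 : ∀ r : ℤ, ((τ (r % N).toNat : unitInterval) : ℝ) < 1 := fun r => by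
      have := hlt _ N (hmod r) le_rfl
      rw [h1] at this
      exact this
    refine ⟨fun r => τ (r % N).toNat + (r / N : ℤ), ?_, ?_, ?_⟩
    · intro r r' hr
      have e := Int.emod_add_mul_ediv r N
      have e' := Int.emod_add_mul_ediv r' N
      rcases lt_trichotomy (r / N) (r' / N) with hq | hq | hq
      · have : ((r / N : ℤ) : ℝ) + 1 ≤ (r' / N : ℤ) := by exact_mod_cast hq
        have := hτ1 r
        have := (τ (r' % N).toNat).2.1
        simp only
        linarith
      · have h3 : (r % N).toNat < (r' % N).toNat := by
          have := Int.emod_nonneg r hNpos.ne'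
          have := Int.emod_nonneg r' hNpos.ne'
          rw [hq] at e
          omega
        have := hlt _ _ h3 (hmod r').le
        simp only [hq]
        have : ((τ (r % N).toNat : unitInterval) : ℝ) < τ (r' % N).toNat := this
        linarith
      · exfalso
        have := Int.ediv_le_ediv hNpos hr.le
        omega
    · intro r n
      rw [hlen]
      simp only [Int.add_mul_emod_self_right, Int.add_mul_ediv_right r n hNpos.ne']
      push_cast
      ring
    · intro r
      have hfr : Int.fract ((τ (r % N).toNat : ℝ) + (r / N : ℤ)) = τ (r % N).toNat := by
        rw [Int.fract_add_intCast]
        exact Int.fract_eq_self.2 ⟨(τ _).2.1, hτ1 r⟩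
      have := hover ((τ (r % N).toNat : ℝ) + (r / N : ℤ))
      simp only [hfr] at this
      rw [SimpleGraph.Walk.cyclicVert, hlen, ← hpt _ (hmod r).le]
      exact this

/-- Disjoint paths that start on the cuff at height `0` meet an essential cycle in the same cyclic
order in which they start. -/
theorem exists_positions {u : V} (C : G.Walk u u) (hC : C.IsCycle)
    (hturn : turn (D.curve C) = 2 * Real.pi) {ι : Type*} (s t : ι → V)
    (P : ∀ i, G.Walk (s i) (t i)) (hP : ∀ i, (P i).IsPath) (hst : ∀ i, s i ≠ t i)
    (hPP : ∀ i i', i ≠ i' → (P i).support.Disjoint (P i').support)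
    (hs : ∀ i, (D.point (s i)).2 = 0)
    (hPC : ∀ i, ∃! v, v ∈ (P i).support ∧ v ∈ C.support)
    (x : ι → ℝ) (hx : ∀ i, Circle.exp (x i) = (D.point (s i)).1) :
    ∃ q : ι → ℤ, (∀ i, C.cyclicVert (q i) ∈ (P i).support) ∧
      ∀ i l (n : ℤ), x i < x l + n * (2 * Real.pi) → q i < q l + n * C.length := by
  obtain ⟨g, hg, hginj, hper, hgo, T, hTmono, hTper, hTo⟩ := D.exists_lift_of_isCycle C hC hturn
  have hNpos : (0 : ℤ) < C.length := by have := hC.three_le_length; omega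
  have hperZ : ∀ (t : ℝ) (n : ℤ), g (t + n) = g t + n * (2 * Real.pi) := by
    intro t n
    induction n using Int.induction_on with
    | zero => simp
    | succ n ih =>
      push_cast at ih ⊢
      rw [← add_assoc, hper, ih]
      ring
    | pred n ih =>
      have := hper (t + ((-n - 1 : ℤ) : ℝ))
      rw [show t + ((-n - 1 : ℤ) : ℝ) + 1 = t + ((-n : ℤ) : ℝ) by push_cast; ring, ih] at this
      push_cast at this ⊢
      linear_combination - this
  have hgi : ∀ t, 0 ≤ (g t).im := fun t => by
    obtain ⟨y, -, hy⟩ := hgo t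
    rw [hy.2]
    exact y.2.2.1
  choose f hf hfi hf0 hfs hfr hfo hfinj using fun i =>
    D.exists_lift_of_isPath (P i) (hP i) (hst i) (hx i)
  choose m hm hmu using hPC
  have hmeet : ∀ i, ∃ τ ∈ Set.Icc (0 : ℝ) 1, LiesOver (f i τ) (D.point (m i)) := fun i =>
    hfo i _ (D.point_mem_range_curve (P i) (hm i).1)
  choose τ hτ hτo using hmeet
  have hq : ∀ i, ∃ q : ℤ, C.cyclicVert q = m i ∧ f i (τ i) = g (T q) := by
    intro i
    obtain ⟨r, hr⟩ : ∃ r : ℤ, C.cyclicVert r = m i := by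
      obtain ⟨n, hn, hnl⟩ := SimpleGraph.Walk.mem_support_iff_exists_getVert.1 (hm i).2
      rcases hnl.lt_or_eq with h | h
      · exact ⟨n, by rw [SimpleGraph.Walk.cyclicVert, Int.emod_eq_of_lt (by omega) (by omega)]; simpa⟩
      · refine ⟨0, ?_⟩
        rw [h, SimpleGraph.Walk.getVert_length] at hn
        simp [SimpleGraph.Walk.cyclicVert, hn]
    have h1 := hTo r
    rw [hr] at h1
    obtain ⟨n, hn⟩ := (hτo i).exists_eq_add h1
    refine ⟨r + n * C.length, ?_, ?_⟩
    · rw [← hr, SimpleGraph.Walk.cyclicVert, SimpleGraph.Walk.cyclicVert,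
        Int.add_mul_emod_self_right]
    · rw [hTper, hperZ, hn]
  choose q hqm hqT using hq
  refine ⟨q, fun i => by rw [hqm]; exact (hm i).1, ?_⟩
  -- A translate of the lift of `P i` meets `g` at one parameter only: the curves meet in common
  -- vertices, `m i` is the only one, and both curves are simple.
  have huniq : ∀ i, ∀ s ∈ Set.Icc (0 : ℝ) 1, ∀ t, ∀ n : ℤ,
      f i s + n * (2 * Real.pi) = g t → t = T (q i) + n := by
    intro i s' hs' t' n h
    obtain ⟨y, hy, hyo⟩ := hfr i s' hs'
    obtain ⟨y', hy', hyo'⟩ := hgo t'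
    rw [← h] at hyo'
    obtain rfl := hyo'.unique (hyo.add n)
    obtain ⟨w, hw, hw', rfl⟩ := D.exists_common_vertex (P i) C
      (edges_disjoint_of_support _ _ fun a b ha ha' hb hb' =>
        (hmu i a ⟨ha, ha'⟩).trans (hmu i b ⟨hb, hb'⟩).symm) hy hy'
    obtain rfl := hmu i w ⟨hw, hw'⟩
    obtain rfl := hfinj i s' hs' (τ i) (hτ i) _ hyo (hτo i)
    rw [hqT, ← hperZ] at h
    exact (hginj h).symm
  intro i l n hil
  by_cases hne : i = l
  · subst hne
    have : 0 < (n : ℝ) * (2 * Real.pi) := by linarith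
    have hn : 0 < (n : ℝ) := pos_of_mul_pos_left this (by positivity)
    have hn' : 0 < n := by exact_mod_cast hn
    have := mul_pos hn' hNpos
    linarith
  -- Comparing `P i` with every translate of `P l` captures the cyclic order, not just the order
  -- within one turn.
  have key := meeting_param_lt hg hginj hper hgi (f₁ := f i)
    (f₂ := fun t => f l t + n * (2 * Real.pi)) (hf i) (by have := hf l; fun_prop) (hfi i)
    (fun s => by simpa using hfi l s) (by rw [(hfs i).2, hs]; simp)
    (by simp [(hfs l).2, hs]) (by
      intro s' hs' t' ht' h
      obtain ⟨y, hy, hyo⟩ := hfr i s' hs'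
      obtain ⟨y', hy', hyo'⟩ := hfr l t' ht'
      rw [h] at hyo
      obtain rfl := hyo.unique (hyo'.add n)
      obtain ⟨w, hw, hw', -⟩ := D.exists_common_vertex (P i) (P l)
        (edges_disjoint_of_support _ _ fun a b ha ha' _ _ => absurd ha' (hPP i l hne ha)) hy hy'
      exact hPP i l hne hw hw') (hτ i) (hτ l) (μ₁ := T (q i)) (μ₂ := T (q l) + n) (hqT i)
    (by rw [hqT l, hperZ])
    (fun s' hs' t' h => by simpa using huniq i s' hs' t' 0 (by simpa using h))
    (fun s' hs' t' h => huniq l s' hs' t' n h) (by simpa [hf0] using hil)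
  rw [← hTper] at key
  exact hTmono.lt_iff_lt.1 key

lemma turn_curve_of_range_eq_cuff {u : V} (C : G.Walk u u) (hC : C.IsCycle) {h : unitInterval}
    (hcuff : Set.range (D.curve C) = cuff h) :
    turn (D.curve C) = 2 * Real.pi ∨ turn (D.curve C) = - (2 * Real.pi) := by
  cases C with
  | nil => exact absurd rfl hC.ne_nil
  | cons e p =>
    rw [← turn_simpleCurve]
    refine abs_turn_eq_of_injOn _ (h := h) (fun t => ?_) (D.simpleCurve_injOn_Ico e p hC)
    have : D.simpleCurve e p t ∈ cuff h := by
      rw [← hcuff, ← range_simpleCurve]; exact ⟨t, rfl⟩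
    exact this

lemma turn_curve_of_homotopicCycles {u v : V} {C : G.Walk u u} {C' : G.Walk v v}
    (h : D.HomotopicCycles C C')
    (hC : turn (D.curve C) = 2 * Real.pi ∨ turn (D.curve C) = - (2 * Real.pi)) :
    turn (D.curve C') = 2 * Real.pi ∨ turn (D.curve C') = - (2 * Real.pi) := by
  rcases h with h | h
  · rwa [← turn_eq_of_freelyHomotopic h]
  · have := turn_eq_of_freelyHomotopic h
    rw [turn_symm] at this
    rcases hC with hC | hC
    · exact .inr (by linarith)
    · exact .inl (by linarith)

end GraphEmbedding

/-! ### Cycles indexed by the integers -/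

namespace SimpleGraph.Walk

variable {V : Type*} {G : SimpleGraph V} {u : V}

/-- `c` runs around the cycle `C`, in one of the two directions. -/
structure IsCyclicParam (C : G.Walk u u) (c : ℤ → V) : Prop where
  periodic : ∀ r n : ℤ, c (r + n * C.length) = c r
  eq_add : ∀ {r r' : ℤ}, c r = c r' → ∃ n : ℤ, r = r' + n * C.length
  adj : ∀ r, G.Adj (c r) (c (r + 1))
  mem_iff : ∀ v, v ∈ C.support ↔ ∃ r, c r = v

lemma IsCyclicParam.comp_neg {C : G.Walk u u} {c : ℤ → V} (h : C.IsCyclicParam c) :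
    C.IsCyclicParam fun r => c (-r) where
  periodic r n := by
    have := h.periodic (-r) (-n)
    rwa [show -r + -n * (C.length : ℤ) = -(r + n * C.length) by ring] at this
  eq_add {r r'} e := by
    obtain ⟨n, hn⟩ := h.eq_add e
    exact ⟨-n, by linarith⟩
  adj r := by
    have := h.adj (-(r + 1))
    rw [show -(r + 1) + 1 = -r by ring] at this
    exact this.symm
  mem_iff v := by
    rw [h.mem_iff]
    exact ⟨fun ⟨r, hr⟩ => ⟨-r, by simpa using hr⟩, fun ⟨r, hr⟩ => ⟨-r, hr⟩⟩

lemma cyclicVert_add_mul (C : G.Walk u u) (r n : ℤ) :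
    C.cyclicVert (r + n * C.length) = C.cyclicVert r := by
  rw [cyclicVert, cyclicVert, Int.add_mul_emod_self_right]

lemma cyclicVert_natCast (C : G.Walk u u) {i : ℕ} (hi : i ≤ C.length) :
    C.cyclicVert i = C.getVert i := by
  rcases hi.lt_or_eq with h | rfl
  · rw [cyclicVert, Int.emod_eq_of_lt (by omega) (by omega)]
    simp
  · simp [cyclicVert]

lemma IsCycle.isCyclicParam {C : G.Walk u u} (hC : C.IsCycle) : C.IsCyclicParam C.cyclicVert := by
  have hN : (0 : ℤ) < C.length := by have := hC.three_le_length; omega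
  have hmod : ∀ r : ℤ, ∃ i : ℕ, i < C.length ∧ C.cyclicVert r = C.getVert i ∧
      r = i + (r / C.length) * C.length := by
    intro r
    have h1 := Int.emod_lt_of_pos r hN
    have h2 := Int.emod_nonneg r hN.ne'
    have h3 := Int.emod_add_mul_ediv r C.length
    refine ⟨(r % C.length).toNat, by omega, rfl, ?_⟩
    rw [Int.toNat_of_nonneg h2]
    linarith
  refine ⟨C.cyclicVert_add_mul, ?_, ?_, ?_⟩
  · intro r r' e
    obtain ⟨i, hi, hi', hr⟩ := hmod r
    obtain ⟨j, hj, hj', hr'⟩ := hmod r'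
    rw [hi', hj'] at e
    have := hC.getVert_injOn' (by simp; omega) (by simp; omega) e
    subst this
    refine ⟨r / C.length - r' / C.length, ?_⟩
    rw [sub_mul]
    linarith
  · intro r
    obtain ⟨i, hi, hi', hr⟩ := hmod r
    have h : C.cyclicVert (r + 1) = C.getVert (i + 1) := by
      have e : r + 1 = ((i + 1 : ℕ) : ℤ) + (r / C.length) * C.length := by push_cast; linarith
      rw [e, cyclicVert_add_mul, C.cyclicVert_natCast hi]
    rw [hi', h]
    exact C.adj_getVert_succ hi
  · intro v
    rw [mem_support_iff_exists_getVert]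
    constructor
    · rintro ⟨n, hn, hnl⟩
      exact ⟨n, by rw [C.cyclicVert_natCast hnl, hn]⟩
    · rintro ⟨r, rfl⟩
      obtain ⟨i, hi, hi', -⟩ := hmod r
      exact ⟨i, hi'.symm, hi.le⟩

lemma cyclicVert_reverse (C : G.Walk u u) (hpos : 0 < C.length) (r : ℤ) :
    C.reverse.cyclicVert r = C.cyclicVert (-r) := by
  have hN : (0 : ℤ) < C.length := by omega
  have h1 := Int.emod_lt_of_pos r hN
  have h2 := Int.emod_nonneg r hN.ne'
  have h3 := Int.emod_add_mul_ediv r C.length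
  rw [cyclicVert, length_reverse, getVert_reverse, ← C.cyclicVert_natCast (Nat.sub_le _ _),
    Nat.cast_sub (by omega), Int.toNat_of_nonneg h2]
  rw [show (C.length : ℤ) - r % C.length = -r + (1 + r / C.length) * C.length by linarith]
  exact C.cyclicVert_add_mul _ _

/-! ### Distances on a cycle in terms of integer positions. -/

section Segments

variable [DecidableEq V]

lemma getVert_rotate (C : G.Walk u u) {x : V} (hx : x ∈ C.support) {i : ℕ}
    (hi : i ≤ C.length) : (C.rotate x hx).getVert i = C.cyclicVert (C.support.idxOf x + i) := by
  have ha : C.support.idxOf x ≤ C.length := by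
    have := List.idxOf_lt_length_of_mem hx
    rw [length_support] at this
    omega
  rw [rotate, getVert_append, length_dropUntil]
  split_ifs with h
  · rw [dropUntil_eq_drop, getVert_copy, drop_getVert, ← C.cyclicVert_natCast (by omega)]
    push_cast
    rfl
  · rw [getVert_takeUntil _ (by rw [length_takeUntil]; omega), ← C.cyclicVert_natCast (by omega),
      ← C.cyclicVert_add_mul _ 1]
    congr 1
    omega

lemma length_rotate' (C : G.Walk u u) {x : V} (hx : x ∈ C.support) :
    (C.rotate x hx).length = C.length := by
  have := congrArg length (C.take_spec hx)
  rw [length_append] at this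
  rw [rotate, length_append]
  omega

lemma mem_support_takeUntil_iff {v w x y : V} (p : G.Walk v w) (hy : y ∈ p.support) :
    x ∈ (p.takeUntil y hy).support ↔ ∃ j ≤ (p.takeUntil y hy).length, p.getVert j = x := by
  rw [mem_support_iff_exists_getVert]
  constructor
  · rintro ⟨j, hj, hjl⟩
    exact ⟨j, hjl, by rw [← hj, getVert_takeUntil hy hjl]⟩
  · rintro ⟨j, hjl, hj⟩
    exact ⟨j, by rw [← hj, getVert_takeUntil hy hjl], hjl⟩

lemma mem_support_dropUntil_iff {v w x y : V} (p : G.Walk v w) (hy : y ∈ p.support) :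
    x ∈ (p.dropUntil y hy).support ↔
      ∃ j, (p.takeUntil y hy).length ≤ j ∧ j ≤ p.length ∧ p.getVert j = x := by
  have hlen : p.support.idxOf y ≤ p.length := by
    have := List.idxOf_lt_length_of_mem hy
    rw [length_support] at this
    omega
  rw [mem_support_iff_exists_getVert, length_dropUntil, length_takeUntil, dropUntil_eq_drop]
  simp only [getVert_copy, drop_getVert]
  constructor
  · rintro ⟨j, hj, hjl⟩
    exact ⟨_, Nat.le_add_right _ _, by omega, hj⟩
  · rintro ⟨j, h1, h2, hj⟩
    exact ⟨j - p.support.idxOf y, by rw [Nat.add_sub_cancel' h1, hj], by omega⟩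

/-- The two open segments between two vertices of a cycle. -/
lemma IsCycle.segments_eq {C : G.Walk u u} (hC : C.IsCycle) {α β : ℤ} (hαβ : α ≤ β)
    (hβ : β < α + C.length) {x y : V} (hxα : C.cyclicVert α = x) (hyβ : C.cyclicVert β = y)
    (hx : x ∈ C.support) (hy : y ∈ C.support) :
    segmentFrom C x y hx hy = (Finset.Ioo α β).image C.cyclicVert ∧
      segmentBack C x y hx hy = (Finset.Ioo β (α + C.length)).image C.cyclicVert := by
  have hN : (0 : ℤ) < C.length := by have := hC.three_le_length; omega
  have hpar := hC.isCyclicParam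
  have hlt : ∀ {r r' : ℤ}, C.cyclicVert r = C.cyclicVert r' → r < r' + C.length →
      r' < r + C.length → r = r' := by
    intro r r' e h1 h2
    obtain ⟨n, hn⟩ := hpar.eq_add e
    have h3 : n < 1 := by by_contra! h; nlinarith
    have h4 : -1 < n := by by_contra! h; nlinarith
    obtain rfl : n = 0 := by omega
    simpa using hn
  set W := C.rotate x hx with hW
  have hy' : y ∈ W.support := (C.mem_support_rotate_iff x hx).2 hy
  have hWlen : W.length = C.length := C.length_rotate' hx
  have hWv : ∀ i : ℕ, i ≤ C.length → W.getVert i = C.cyclicVert (α + i) := by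
    intro i hi
    rw [hW, C.getVert_rotate hx hi]
    have e : C.cyclicVert (C.support.idxOf x : ℤ) = C.cyclicVert α := by
      rw [hxα, C.cyclicVert_natCast, C.getVert_support_idxOf hx]
      have := List.idxOf_lt_length_of_mem hx
      rw [length_support] at this
      omega
    obtain ⟨n, hn⟩ := hpar.eq_add e
    rw [hn, ← hpar.periodic (α + i) n]
    congr 1
    ring
  set b := (W.takeUntil y hy').length with hb
  have hbN : b ≤ C.length := hWlen ▸ W.length_takeUntil_le_length hy'
  have hby : C.cyclicVert (α + b) = y := by
    rw [← hWv b hbN]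
    exact W.getVert_length_takeUntil hy'
  -- Both sides are positions of `y`, so it is enough that they are less than one turn apart. The
  -- only doubtful case is `b = C.length` with `α = β`; but then `x = y`, and the walk up to `y` has
  -- length 0.
  have hbβ : α + b = β := by
    refine hlt (hby.trans hyβ.symm) ?_ (by omega)
    rcases hbN.lt_or_eq with h | h
    · omega
    · rcases hαβ.lt_or_eq with h' | h'
      · omega
      · exfalso
        have hxy : x = y := by rw [← hxα, ← hyβ, h']
        have : b = 0 := by
          rw [hb, length_eq_zero_iff]
          subst hxy
          simp
        omega
  have hxN : C.cyclicVert (α + C.length) = x := by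
    rw [← hxα, ← hpar.periodic α 1, one_mul]
  constructor
  · ext v
    simp only [segmentFrom, Finset.mem_sdiff, List.mem_toFinset, Finset.mem_insert,
      Finset.mem_singleton, Finset.mem_image, Finset.mem_Ioo, not_or]
    rw [mem_support_takeUntil_iff]
    constructor
    · rintro ⟨⟨j, hj, rfl⟩, hvx, hvy⟩
      have hj : j ≤ b := hj
      have hv := hWv j (by omega)
      refine ⟨α + j, ⟨?_, ?_⟩, hv.symm⟩
      · rcases Nat.eq_zero_or_pos j with rfl | h
        · exact absurd (by simp) hvx
        · omega
      · rcases hj.lt_or_eq with h | rfl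
        · omega
        · exact absurd (hv.trans hby) hvy
    · rintro ⟨r, ⟨h1, h2⟩, rfl⟩
      refine ⟨⟨(r - α).toNat, ?_, ?_⟩, ?_, ?_⟩
      · change _ ≤ b
        omega
      · change W.getVert _ = _
        rw [hWv _ (by omega)]
        congr 1
        omega
      · rw [← hxα]
        intro e
        have := hlt e (by omega) (by omega)
        omega
      · rw [← hyβ]
        intro e
        have := hlt e (by omega) (by omega)
        omega
  · ext v
    simp only [segmentBack, Finset.mem_sdiff, List.mem_toFinset, Finset.mem_insert,
      Finset.mem_singleton, Finset.mem_image, Finset.mem_Ioo, not_or]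
    rw [mem_support_dropUntil_iff]
    constructor
    · rintro ⟨⟨j, hj, hjl, rfl⟩, hvx, hvy⟩
      have hj : b ≤ j := hj
      have hjl : j ≤ W.length := hjl
      have hv := hWv j (by omega)
      refine ⟨α + j, ⟨?_, ?_⟩, hv.symm⟩
      · rcases hj.lt_or_eq with h | rfl
        · omega
        · exact absurd (hv.trans hby) hvy
      · rcases hjl.lt_or_eq with h | rfl
        · omega
        · rw [hWlen] at hv
          exact absurd (by rw [hWlen]; exact hv.trans hxN) hvx
    · rintro ⟨r, ⟨h1, h2⟩, rfl⟩
      refine ⟨⟨(r - α).toNat, ?_, ?_, ?_⟩, ?_, ?_⟩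
      · change b ≤ _
        omega
      · change _ ≤ W.length
        omega
      · change W.getVert _ = _
        rw [hWv _ (by omega)]
        congr 1
        omega
      · rw [← hxN]
        intro e
        have := hlt e (by omega) (by omega)
        omega
      · rw [← hyβ]
        intro e
        have := hlt e (by omega) (by omega)
        omega

/-- `c` runs around the cycle `C`, and the distances on `C` can be read off from `c`. -/
structure IsMetricParam (C : G.Walk u u) (c : ℤ → V) : Prop extends IsCyclicParam C c where
  dist_eq : ∀ {α β : ℤ} (_ : α ≤ β) (_ : β < α + C.length) (S : Finset V) {x y : V}
    (_ : c α = x) (_ : c β = y) (hx : x ∈ C.support) (hy : y ∈ C.support),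
    cycleDist C S x y hx hy = min ((Finset.Ioo α β).image c ∩ S).card
      ((Finset.Ioo β (α + C.length)).image c ∩ S).card

lemma IsCycle.isMetricParam {C : G.Walk u u} (hC : C.IsCycle) : C.IsMetricParam C.cyclicVert where
  toIsCyclicParam := hC.isCyclicParam
  dist_eq h1 h2 S x y hxα hyβ hx hy := by
    obtain ⟨e1, e2⟩ := hC.segments_eq h1 h2 hxα hyβ hx hy
    rw [cycleDist, e1, e2]

/-- Reversal swaps the two open segments, which the minimum does not notice. For `α = β` there is no
swap: the empty segment remains the first one. -/
lemma IsCycle.isMetricParam_reverse {C : G.Walk u u} (hC : C.IsCycle) :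
    C.IsMetricParam C.reverse.cyclicVert := by
  have hN : (0 : ℤ) < C.length := by have := hC.three_le_length; omega
  have hpar := hC.isCyclicParam
  rw [show C.reverse.cyclicVert = fun r => C.cyclicVert (-r) from
    funext (C.cyclicVert_reverse (by omega))]
  refine ⟨hC.isCyclicParam.comp_neg, ?_⟩
  intro α β h1 h2 S x y hxα hyβ hx hy
  have himage : ∀ a b n : ℤ, (Finset.Ioo a b).image C.cyclicVert =
      (Finset.Ioo (n * C.length - b) (n * C.length - a)).image fun r => C.cyclicVert (-r) := by
    intro a b n
    ext v
    simp only [Finset.mem_image, Finset.mem_Ioo]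
    constructor
    · rintro ⟨r, ⟨h1, h2⟩, rfl⟩
      refine ⟨n * C.length - r, ⟨by omega, by omega⟩, ?_⟩
      rw [← hpar.periodic r (-n)]
      congr 1
      ring
    · rintro ⟨r, ⟨h1, h2⟩, rfl⟩
      refine ⟨n * C.length - r, ⟨by omega, by omega⟩, ?_⟩
      rw [← hpar.periodic (-r) n]
      congr 1
      ring
  rcases h1.lt_or_eq with h1 | rfl
  · obtain ⟨e1, e2⟩ := hC.segments_eq (α := -α) (β := -β + 1 * C.length) (by omega) (by omega) hxα
      (by rw [hpar.periodic]; exact hyβ) hx hy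
    rw [himage _ _ 1] at e1 e2
    rw [cycleDist, e1, e2, min_comm]
    congr 4 <;> congr 1 <;> ring_nf
  · obtain ⟨e1, e2⟩ := hC.segments_eq (α := -α) (β := -α) (by omega) (by omega) hxα hyβ hx hy
    rw [himage _ _ 0] at e1
    rw [himage _ _ 1] at e2
    rw [cycleDist, e1, e2]
    congr 4 <;> congr 1 <;> ring_nf

end Segments

end SimpleGraph.Walk

/-! ### Cycles with seven labels and the `K₆` minor -/

/-- A monotone labelling of the integers with prescribed labels, equivariant for the translations by
`N` on positions and by `7` on labels. -/
lemma exists_labelling {N : ℤ} (hN : 0 < N) {σ : ℤ → ℤ} (hσ : StrictMono σ)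
    (hper : ∀ i n : ℤ, σ (i + n * 7) = σ i + n * N) {m : ℕ} {α u : Fin m → ℤ} (hα : StrictMono α)
    (hαN : ∀ i j, α i < α j + N) (hu : Monotone u) (huN : ∀ i j, u i ≤ u j + 7)
    (hlo : ∀ t i, σ i ≤ α t → i ≤ u t) (hhi : ∀ t i, α t ≤ σ i → u t ≤ i) :
    ∃ φ : ℤ → ℤ, Monotone φ ∧ (∀ x n : ℤ, φ (x + n * N) = φ x + n * 7) ∧ (∀ i, φ (σ i) = i) ∧
      ∀ t, φ (α t) = u t := by
  -- `R` collects the prescribed pairs of position and label with all their translates. The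
  -- compatibility conditions make it monotone, and `φ x` will be the greatest label prescribed at
  -- or before `x`.
  set R : ℤ → ℤ → Prop := fun x i => σ i = x ∨ ∃ t, ∃ n : ℤ, x = α t + n * N ∧ i = u t + n * 7
    with hR
  have hRσ : ∀ i, R (σ i) i := fun i => .inl rfl
  have hRper : ∀ {x i} (n : ℤ), R x i → R (x + n * N) (i + n * 7) := by
    rintro x i n (rfl | ⟨t, n', rfl, rfl⟩)
    · exact .inl (hper i n)
    · exact .inr ⟨t, n' + n, by ring, by ring⟩
  have hmono : ∀ {x y i j}, R x i → R y j → x ≤ y → i ≤ j := by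
    rintro x y i j (rfl | ⟨t, n, rfl, rfl⟩) (rfl | ⟨t', n', rfl, rfl⟩) hxy
    · exact hσ.le_iff_le.1 hxy
    · have := hlo t' (i + (-n') * 7) (by rw [hper]; linarith)
      linarith
    · have := hhi t (j + (-n) * 7) (by rw [hper]; linarith)
      linarith
    · rcases lt_trichotomy n' n with h | rfl | h
      · exfalso
        have := hαN t' t
        nlinarith
      · have : α t ≤ α t' := by linarith
        have := hu (hα.le_iff_le.1 this)
        linarith
      · have := huN t t'
        nlinarith
  have hub : ∀ x, ∃ i, x ≤ σ i := fun x => by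
    refine ⟨0 + |x - σ 0| * 7, ?_⟩
    rw [hper]
    have := le_abs_self (x - σ 0)
    have := abs_nonneg (x - σ 0)
    nlinarith
  have hlb : ∀ x, ∃ i, σ i ≤ x := fun x => by
    refine ⟨0 + (-|x - σ 0|) * 7, ?_⟩
    rw [hper]
    have := neg_abs_le (x - σ 0)
    have := abs_nonneg (x - σ 0)
    nlinarith
  have hex : ∀ x, ∃ i, (∃ y ≤ x, R y i) ∧ ∀ j, (∃ y ≤ x, R y j) → j ≤ i := by
    intro x
    obtain ⟨b, hb⟩ := hub x
    obtain ⟨a, ha⟩ := hlb x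
    exact Int.exists_greatest_of_bdd ⟨b, fun z ⟨y, hy, hRy⟩ => hmono hRy (hRσ b) (hy.trans hb)⟩
      ⟨a, σ a, ha, hRσ a⟩
  choose φ hφ hφmax using hex
  have hval : ∀ {x i}, R x i → φ x = i := by
    intro x i h
    obtain ⟨y, hy, hRy⟩ := hφ x
    exact le_antisymm (hmono hRy h hy) (hφmax x i ⟨x, le_rfl, h⟩)
  have hle : ∀ x n : ℤ, φ x + n * 7 ≤ φ (x + n * N) := by
    intro x n
    obtain ⟨y, hy, hRy⟩ := hφ x
    exact hφmax _ _ ⟨y + n * N, by linarith, hRper n hRy⟩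
  refine ⟨φ, ?_, ?_, fun i => hval (hRσ i), fun t => hval (.inr ⟨t, 0, by ring, by ring⟩)⟩
  · intro x y hxy
    obtain ⟨z, hz, hRz⟩ := hφ x
    exact hφmax y _ ⟨z, hz.trans hxy, hRz⟩
  · intro x n
    refine le_antisymm ?_ (hle x n)
    have := hle (x + n * N) (-n)
    rw [show x + n * N + -n * N = x by ring] at this
    linarith

/-- A cycle of a graph, run through by `c`, with a surjective monotone map of its vertices to
the labels modulo `7`. The vertex at position `σ i` has label `i`. -/
structure LabelledCycle {V : Type*} (G : SimpleGraph V) where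
  c : ℤ → V
  N : ℤ
  φ : ℤ → ℤ
  σ : ℤ → ℤ
  c_add : ∀ r n : ℤ, c (r + n * N) = c r
  eq_add : ∀ {r r' : ℤ}, c r = c r' → ∃ n : ℤ, r = r' + n * N
  adj : ∀ r, G.Adj (c r) (c (r + 1))
  φ_mono : Monotone φ
  φ_add : ∀ x n : ℤ, φ (x + n * N) = φ x + n * 7
  φ_σ : ∀ i, φ (σ i) = i

namespace LabelledCycle

variable {V : Type*} {G : SimpleGraph V} (R : LabelledCycle G)

/-- The vertices with labels between `p` and `q`. -/
def arc (p q : ℤ) : Set V := {v | ∃ x, R.c x = v ∧ p ≤ R.φ x ∧ R.φ x ≤ q}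

lemma mem_arc_of_add {x : ℤ} (n : ℤ) {p q : ℤ} (h1 : p ≤ R.φ x + n * 7) (h2 : R.φ x + n * 7 ≤ q) :
    R.c x ∈ R.arc p q :=
  ⟨x + n * R.N, R.c_add x n, by rwa [R.φ_add], by rwa [R.φ_add]⟩

lemma connected_image_Icc {a b : ℤ} (hab : a ≤ b) : (G.induce (R.c '' Set.Icc a b)).Connected := by
  obtain ⟨n, rfl⟩ := Int.le.dest hab
  induction n with
  | zero =>
    rw [Nat.cast_zero, add_zero, Set.Icc_self, Set.image_singleton]
    exact (SimpleGraph.connected_iff _).2 ⟨SimpleGraph.Preconnected.of_subsingleton, ⟨⟨_, rfl⟩⟩⟩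
  | succ n ih =>
    have : R.c '' Set.Icc a (a + (n + 1 : ℕ)) =
        R.c '' Set.Icc a (a + n) ∪ {R.c (a + n), R.c (a + n + 1)} := by
      rw [← Set.image_pair, ← Set.image_union]
      congr 1
      ext x
      simp only [Set.mem_Icc, Set.mem_union, Set.mem_insert_iff, Set.mem_singleton_iff]
      omega
    rw [this]
    exact SimpleGraph.induce_union_connected (ih (by omega)).preconnected
      (SimpleGraph.induce_pair_connected_of_adj (R.adj _)).preconnected
      ⟨R.c (a + n), ⟨a + n, ⟨by omega, le_rfl⟩, rfl⟩, by simp⟩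

/-- By monotonicity of `φ`, every position between `σ p` and a position of the arc belongs to the
arc again, so all its vertices are joined to the one at `σ p`. -/
lemma arc_connected {p q : ℤ} (hpq : p ≤ q) : (G.induce (R.arc p q)).Connected := by
  refine SimpleGraph.induce_connected_of_patches (R.c (R.σ p))
    ⟨_, rfl, by rw [R.φ_σ], by rwa [R.φ_σ]⟩ ?_
  rintro _ ⟨x, rfl, h1, h2⟩
  refine ⟨R.c '' Set.Icc (min (R.σ p) x) (max (R.σ p) x), ?_, ⟨_, ⟨min_le_left _ _, le_max_left _ _⟩, rfl⟩,
    ⟨_, ⟨min_le_right _ _, le_max_right _ _⟩, rfl⟩,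
    (R.connected_image_Icc (min_le_max)).preconnected _ _⟩
  rintro _ ⟨y, ⟨hy1, hy2⟩, rfl⟩
  refine ⟨y, rfl, ?_, ?_⟩
  · rcases min_le_iff.1 hy1 with h | h
    · simpa [R.φ_σ] using R.φ_mono h
    · exact h1.trans (R.φ_mono h)
  · rcases le_max_iff.1 hy2 with h | h
    · have := R.φ_mono h
      rw [R.φ_σ] at this
      omega
    · exact (R.φ_mono h).trans h2

lemma arc_disjoint {p q p' q' : ℤ} (h1 : q < p') (h2 : q' < p + 7) :
    Disjoint (R.arc p q) (R.arc p' q') := by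
  rw [Set.disjoint_left]
  rintro _ ⟨x, rfl, hx1, hx2⟩ ⟨y, hy, hy1, hy2⟩
  obtain ⟨n, rfl⟩ := R.eq_add hy
  rw [R.φ_add] at hy1 hy2
  omega

/-- Every label is taken, so a monotone labelling cannot skip one: look just after the last position
with label at most `i`. -/
lemma exists_label_succ (i : ℤ) : ∃ x, R.φ x = i ∧ R.φ (x + 1) = i + 1 := by
  obtain ⟨x, hx, hmax⟩ := Int.exists_greatest_of_bdd (P := fun x => R.φ x ≤ i)
    ⟨R.σ (i + 1), fun z hz => by
      by_contra! h
      have := R.φ_mono h.le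
      rw [R.φ_σ] at this
      omega⟩ ⟨R.σ i, by rw [R.φ_σ]⟩
  have h1 : i ≤ R.φ x := by
    have := R.φ_mono (hmax (R.σ i) (by rw [R.φ_σ]))
    rwa [R.φ_σ] at this
  have h2 : i < R.φ (x + 1) := by
    by_contra! h
    have := hmax _ h
    omega
  have h3 : R.φ (x + 1) ≤ i + 1 := by
    have : x < R.σ (i + 1) := by
      by_contra! h
      have := R.φ_mono h
      rw [R.φ_σ] at this
      omega
    have := R.φ_mono (show x + 1 ≤ R.σ (i + 1) by omega)
    rwa [R.φ_σ] at this
  exact ⟨x, by omega, by omega⟩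

/-- Two arcs the second of which begins, modulo `7`, where the first one ends are adjacent. -/
lemma exists_adj_arc {p q p' q' : ℤ} (n : ℤ) (hpq : p ≤ q) (hpq' : p' ≤ q')
    (h : q + 1 = p' + n * 7) :
    ∃ x ∈ R.arc p q, ∃ y ∈ R.arc p' q', G.Adj x y := by
  obtain ⟨x, h1, h2⟩ := R.exists_label_succ q
  exact ⟨R.c x, ⟨x, rfl, by omega, by omega⟩, R.c (x + 1),
    R.mem_arc_of_add (-n) (by omega) (by omega), R.adj x⟩

end LabelledCycle

/-- Three disjoint labelled cycles, linked by seven disjoint connected subgraphs. -/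
structure Frame {V : Type*} (G : SimpleGraph V) where
  R₁ : LabelledCycle G
  R₂ : LabelledCycle G
  R₃ : LabelledCycle G
  Q : ℤ → Set V
  disj₁₂ : ∀ x y, R₁.c x ≠ R₂.c y
  disj₁₃ : ∀ x y, R₁.c x ≠ R₃.c y
  disj₂₃ : ∀ x y, R₂.c x ≠ R₃.c y
  Q_add : ∀ i n : ℤ, Q (i + n * 7) = Q i
  Q_connected : ∀ i, (G.induce (Q i)).Connected
  Q_disj : ∀ i j v, v ∈ Q i → v ∈ Q j → ∃ n : ℤ, i = j + n * 7
  Q_disj₁ : ∀ i x, R₁.c x ∉ Q i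
  Q_disj₃ : ∀ i x, R₃.c x ∉ Q i
  mem_Q₂ : ∀ i, R₂.c (R₂.σ i) ∈ Q i
  Q_inter₂ : ∀ i x, R₂.c x ∈ Q i → R₂.c x = R₂.c (R₂.σ i)
  adj₁ : ∀ i, ∃ v ∈ Q i, G.Adj (R₁.c (R₁.σ i)) v
  adj₃ : ∀ i, ∃ v ∈ Q i, G.Adj (R₃.c (R₃.σ i)) v

lemma completeGraph_isMinorOf {V : Type*} {G : SimpleGraph V} {n : ℕ} (B : Fin n → Set V)
    (hconn : ∀ i, (G.induce (B i)).Connected)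
    (h : ∀ i j, i < j → Disjoint (B i) (B j) ∧ ∃ x ∈ B i, ∃ y ∈ B j, G.Adj x y) :
    (SimpleGraph.completeGraph (Fin n)).IsMinorOf G := by
  refine ⟨B, hconn, fun i j hij => ?_, fun i j hij => ?_⟩
  · rcases lt_or_gt_of_ne hij with h' | h'
    · exact (h i j h').1
    · exact (h j i h').1.symm
  · rcases lt_or_gt_of_ne (SimpleGraph.Adj.ne hij) with h' | h'
    · exact (h i j h').2
    · obtain ⟨x, hx, y, hy, hxy⟩ := (h j i h').2
      exact ⟨y, hy, x, hx, hxy.symm⟩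

/-! ### Branch sets in a frame. -/

namespace Frame

variable {V : Type*} {G : SimpleGraph V} (F : Frame G)

/-- The part of the middle cycle with labels between `p` and `q`, together with the links at it. -/
def middle (p q : ℤ) : Set V := F.R₂.arc p q ∪ {v | ∃ i, p ≤ i ∧ i ≤ q ∧ v ∈ F.Q i}

lemma middle_connected {p q : ℤ} (hpq : p ≤ q) : (G.induce (F.middle p q)).Connected := by
  have hp : F.R₂.c (F.R₂.σ p) ∈ F.R₂.arc p q := ⟨_, rfl, by rw [F.R₂.φ_σ], by rwa [F.R₂.φ_σ]⟩
  refine SimpleGraph.induce_connected_of_patches (F.R₂.c (F.R₂.σ p)) (.inl hp) ?_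
  rintro v (hv | ⟨i, h1, h2, hv⟩)
  · exact ⟨F.R₂.arc p q, Set.subset_union_left, hp, hv, (F.R₂.arc_connected hpq).preconnected _ _⟩
  · refine ⟨F.R₂.arc p q ∪ F.Q i, Set.union_subset_union_right _ fun w hw => ⟨i, h1, h2, hw⟩,
      .inl hp, .inr hv, (SimpleGraph.induce_union_connected (F.R₂.arc_connected hpq).preconnected
        (F.Q_connected i).preconnected ⟨F.R₂.c (F.R₂.σ i), ⟨_, rfl, ?_, ?_⟩,
          F.mem_Q₂ i⟩).preconnected _ _⟩ <;> rwa [F.R₂.φ_σ]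

lemma middle_disjoint {p q p' q' : ℤ} (h1 : q < p') (h2 : q' < p + 7) :
    Disjoint (F.middle p q) (F.middle p' q') := by
  have hmix : ∀ x i, F.R₂.c x ∈ F.Q i → ∃ n : ℤ, F.R₂.φ x = i + n * 7 := by
    intro x i h
    obtain ⟨n, rfl⟩ := F.R₂.eq_add (F.Q_inter₂ i x h)
    exact ⟨n, by rw [F.R₂.φ_add, F.R₂.φ_σ]⟩
  rw [Set.disjoint_left]
  rintro v (hv | ⟨i, hi1, hi2, hv⟩) (hv' | ⟨j, hj1, hj2, hv'⟩)
  · exact Set.disjoint_left.1 (F.R₂.arc_disjoint h1 h2) hv hv'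
  · obtain ⟨x, rfl, hx1, hx2⟩ := hv
    obtain ⟨n, hn⟩ := hmix x j hv'
    omega
  · obtain ⟨x, rfl, hx1, hx2⟩ := hv'
    obtain ⟨n, hn⟩ := hmix x i hv
    omega
  · obtain ⟨n, hn⟩ := F.Q_disj i j v hv hv'
    omega

lemma disjoint_arc₁_middle (p q p' q' : ℤ) : Disjoint (F.R₁.arc p q) (F.middle p' q') := by
  rw [Set.disjoint_left]
  rintro v ⟨x, rfl, -⟩ (⟨y, hy, -⟩ | ⟨i, -, -, hv⟩)
  · exact F.disj₁₂ _ _ hy.symm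
  · exact F.Q_disj₁ _ _ hv

lemma disjoint_arc₃_middle (p q p' q' : ℤ) : Disjoint (F.R₃.arc p q) (F.middle p' q') := by
  rw [Set.disjoint_left]
  rintro v ⟨x, rfl, -⟩ (⟨y, hy, -⟩ | ⟨i, -, -, hv⟩)
  · exact F.disj₂₃ _ _ hy
  · exact F.Q_disj₃ _ _ hv

lemma disjoint_arc₁_arc₃ (p q p' q' : ℤ) : Disjoint (F.R₁.arc p q) (F.R₃.arc p' q') := by
  rw [Set.disjoint_left]
  rintro v ⟨x, rfl, -⟩ ⟨y, hy, -⟩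
  exact F.disj₁₃ _ _ hy.symm

/-- Two sets of labels, given by intervals, that have an element in common modulo `7`. -/
def Meet (p q p' q' : ℤ) : Prop := ∃ i n : ℤ, p ≤ i ∧ i ≤ q ∧ p' ≤ i + n * 7 ∧ i + n * 7 ≤ q'

lemma exists_adj_arc₁_middle {p q p' q' : ℤ} (h : Meet p q p' q') :
    ∃ x ∈ F.R₁.arc p' q', ∃ y ∈ F.middle p q, G.Adj x y := by
  obtain ⟨i, n, h1, h2, h3, h4⟩ := h
  obtain ⟨v, hv, hadj⟩ := F.adj₁ (i + n * 7)
  rw [F.Q_add] at hv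
  exact ⟨_, ⟨_, rfl, by rwa [F.R₁.φ_σ], by rwa [F.R₁.φ_σ]⟩, v, .inr ⟨i, h1, h2, hv⟩, hadj⟩

lemma exists_adj_arc₃_middle {p q p' q' : ℤ} (h : Meet p q p' q') :
    ∃ x ∈ F.R₃.arc p' q', ∃ y ∈ F.middle p q, G.Adj x y := by
  obtain ⟨i, n, h1, h2, h3, h4⟩ := h
  obtain ⟨v, hv, hadj⟩ := F.adj₃ (i + n * 7)
  rw [F.Q_add] at hv
  exact ⟨_, ⟨_, rfl, by rwa [F.R₃.φ_σ], by rwa [F.R₃.φ_σ]⟩, v, .inr ⟨i, h1, h2, hv⟩, hadj⟩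

lemma exists_adj_middle {p q p' q' : ℤ} (n : ℤ) (hpq : p ≤ q) (hpq' : p' ≤ q')
    (h : q + 1 = p' + n * 7) : ∃ x ∈ F.middle p q, ∃ y ∈ F.middle p' q', G.Adj x y := by
  obtain ⟨x, hx, y, hy, hxy⟩ := F.R₂.exists_adj_arc n hpq hpq' h
  exact ⟨x, .inl hx, y, .inl hy, hxy⟩

/-- The `K₆` minor given by arcs `A`, `A'` of the first cycle, `B`, `B'` of the third cycle and three
arcs of the middle cycle, where an edge joins `A` to `B` and another one joins `A'` to `B'`. -/
theorem isMinorOf_of_arcs {G' : SimpleGraph V} (hG : G ≤ G') {p p' q q' y₀ y₁ y₂ : ℤ}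
    (hp : p ≤ p') (hp' : p' < p + 6) (hq : q ≤ q') (hq' : q' < q + 6)
    (hy₀ : y₀ < y₁) (hy₁ : y₁ < y₂) (hy₂ : y₂ < y₀ + 7)
    (hA₀ : Meet y₀ (y₁ - 1) p p' ∨ Meet y₀ (y₁ - 1) q q')
    (hA₁ : Meet y₁ (y₂ - 1) p p' ∨ Meet y₁ (y₂ - 1) q q')
    (hA₂ : Meet y₂ (y₀ + 6) p p' ∨ Meet y₂ (y₀ + 6) q q')
    (hA'₀ : Meet y₀ (y₁ - 1) (p' + 1) (p + 6)) (hA'₁ : Meet y₁ (y₂ - 1) (p' + 1) (p + 6))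
    (hA'₂ : Meet y₂ (y₀ + 6) (p' + 1) (p + 6))
    (hB'₀ : Meet y₀ (y₁ - 1) (q' + 1) (q + 6)) (hB'₁ : Meet y₁ (y₂ - 1) (q' + 1) (q + 6))
    (hB'₂ : Meet y₂ (y₀ + 6) (q' + 1) (q + 6))
    {a a' b b' : V} (ha : a ∈ F.R₁.arc p p') (ha' : a' ∈ F.R₁.arc (p' + 1) (p + 6))
    (hb : b ∈ F.R₃.arc q q') (hb' : b' ∈ F.R₃.arc (q' + 1) (q + 6))
    (hab : G'.Adj a b) (hab' : G'.Adj a' b') :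
    (SimpleGraph.completeGraph (Fin 6)).IsMinorOf G' := by
  have mono : ∀ {X : Set V}, (G.induce X).Connected → (G'.induce X).Connected := fun h =>
    h.mono (SimpleGraph.comap_monotone _ hG)
  have lift : ∀ {X Y : Set V}, (∃ x ∈ X, ∃ y ∈ Y, G.Adj x y) → ∃ x ∈ X, ∃ y ∈ Y, G'.Adj x y :=
    fun ⟨x, hx, y, hy, h⟩ => ⟨x, hx, y, hy, hG h⟩
  have left : ∀ {X X' Y : Set V}, (∃ x ∈ X, ∃ y ∈ Y, G.Adj x y) →
      ∃ x ∈ X ∪ X', ∃ y ∈ Y, G'.Adj x y :=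
    fun ⟨x, hx, y, hy, h⟩ => ⟨x, .inl hx, y, hy, hG h⟩
  have right : ∀ {X X' Y : Set V}, (∃ x ∈ X', ∃ y ∈ Y, G.Adj x y) →
      ∃ x ∈ X ∪ X', ∃ y ∈ Y, G'.Adj x y :=
    fun ⟨x, hx, y, hy, h⟩ => ⟨x, .inr hx, y, hy, hG h⟩
  have joint : ∀ {y y' : ℤ}, Meet y y' p p' ∨ Meet y y' q q' →
      ∃ x ∈ F.R₁.arc p p' ∪ F.R₃.arc q q', ∃ z ∈ F.middle y y', G'.Adj x z := fun h =>
    h.elim (fun h => left (F.exists_adj_arc₁_middle h)) fun h => right (F.exists_adj_arc₃_middle h)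
  have dis : ∀ y y' : ℤ, Disjoint (F.R₁.arc p p' ∪ F.R₃.arc q q') (F.middle y y') := fun y y' =>
    Set.disjoint_union_left.2 ⟨F.disjoint_arc₁_middle _ _ _ _, F.disjoint_arc₃_middle _ _ _ _⟩
  -- In this order: two arcs joined by the edge `ab`, their complementary arcs, which are adjacent
  -- through `a'b'`, and three pieces around the middle cycle.
  refine completeGraph_isMinorOf ![F.R₁.arc p p' ∪ F.R₃.arc q q', F.R₁.arc (p' + 1) (p + 6),
    F.R₃.arc (q' + 1) (q + 6), F.middle y₀ (y₁ - 1), F.middle y₁ (y₂ - 1),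
    F.middle y₂ (y₀ + 6)] ?_ ?_
  · intro i
    fin_cases i
    · exact SimpleGraph.connected_induce_union (mono (F.R₁.arc_connected hp)).preconnected
        (mono (F.R₃.arc_connected hq)).preconnected ha hb hab
    · exact mono (F.R₁.arc_connected (by omega))
    · exact mono (F.R₃.arc_connected (by omega))
    · exact mono (F.middle_connected (by omega))
    · exact mono (F.middle_connected (by omega))
    · exact mono (F.middle_connected (by omega))
  · intro i j hij
    fin_cases i <;> fin_cases j <;> first | exact absurd hij (by decide) | skip
    · exact ⟨Set.disjoint_union_left.2 ⟨F.R₁.arc_disjoint (by omega) (by omega),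
        (F.disjoint_arc₁_arc₃ _ _ _ _).symm⟩, left (F.R₁.exists_adj_arc 0 hp (by omega) (by omega))⟩
    · exact ⟨Set.disjoint_union_left.2 ⟨F.disjoint_arc₁_arc₃ _ _ _ _,
        F.R₃.arc_disjoint (by omega) (by omega)⟩,
        right (F.R₃.exists_adj_arc 0 hq (by omega) (by omega))⟩
    · exact ⟨dis _ _, joint hA₀⟩
    · exact ⟨dis _ _, joint hA₁⟩
    · exact ⟨dis _ _, joint hA₂⟩
    · exact ⟨F.disjoint_arc₁_arc₃ _ _ _ _, a', ha', b', hb', hab'⟩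
    · exact ⟨F.disjoint_arc₁_middle _ _ _ _, lift (F.exists_adj_arc₁_middle hA'₀)⟩
    · exact ⟨F.disjoint_arc₁_middle _ _ _ _, lift (F.exists_adj_arc₁_middle hA'₁)⟩
    · exact ⟨F.disjoint_arc₁_middle _ _ _ _, lift (F.exists_adj_arc₁_middle hA'₂)⟩
    · exact ⟨F.disjoint_arc₃_middle _ _ _ _, lift (F.exists_adj_arc₃_middle hB'₀)⟩
    · exact ⟨F.disjoint_arc₃_middle _ _ _ _, lift (F.exists_adj_arc₃_middle hB'₁)⟩
    · exact ⟨F.disjoint_arc₃_middle _ _ _ _, lift (F.exists_adj_arc₃_middle hB'₂)⟩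
    · exact ⟨F.middle_disjoint (by omega) (by omega),
        lift (F.exists_adj_middle 0 (by omega) (by omega) (by omega))⟩
    · refine ⟨F.middle_disjoint (by omega) (by omega), ?_⟩
      -- The third piece is followed by the first one after a full turn, hence the shift by one
      -- period.
      obtain ⟨x, hx, y, hy, h⟩ := F.exists_adj_middle 1 (p := y₂) (q := y₀ + 6) (p' := y₀)
        (q' := y₁ - 1) (by omega) (by omega) (by omega)
      exact ⟨y, hy, x, hx, hG h.symm⟩
    · exact ⟨F.middle_disjoint (by omega) (by omega),
        lift (F.exists_adj_middle 0 (by omega) (by omega) (by omega))⟩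

end Frame

/-- The labels `u`, `u'` of vertices on the first cycle and `v`, `v'` of vertices on the third cycle
are separated by one of the two standard pairs of arcs. -/
def WellSeparated (u v u' v' : ℤ) : Prop :=
  ∃ r : ℤ, (u - r) % 7 ≤ 2 ∧ 3 ≤ (u' - r) % 7 ∧
    ((v - r - 2) % 7 ≤ 2 ∧ 3 ≤ (v' - r - 2) % 7 ∨ (v - r + 2) % 7 ≤ 2 ∧ 3 ≤ (v' - r + 2) % 7)

theorem Frame.isMinorOf_of_wellSeparated {V : Type*} {G G' : SimpleGraph V} (F : Frame G)
    (hG : G ≤ G') {α β α' β' : ℤ}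
    (h : WellSeparated (F.R₁.φ α) (F.R₃.φ β) (F.R₁.φ α') (F.R₃.φ β'))
    (hab : G'.Adj (F.R₁.c α) (F.R₃.c β)) (hab' : G'.Adj (F.R₁.c α') (F.R₃.c β')) :
    (SimpleGraph.completeGraph (Fin 6)).IsMinorOf G' := by
  obtain ⟨r, hu, hu', hv⟩ := h
  have key : ∀ (R : LabelledCycle G) (x r : ℤ),
      ((R.φ x - r) % 7 ≤ 2 → R.c x ∈ R.arc r (r + 2)) ∧
      (3 ≤ (R.φ x - r) % 7 → R.c x ∈ R.arc (r + 2 + 1) (r + 6)) := fun R x r =>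
    ⟨fun h => R.mem_arc_of_add (-((R.φ x - r) / 7)) (by omega) (by omega),
      fun h => R.mem_arc_of_add (-((R.φ x - r) / 7)) (by omega) (by omega)⟩
  -- The arc on the third cycle is `[r, r + 2]` moved by two labels, forwards or backwards. Together
  -- these arcs cover five labels modulo 7, and each complementary arc has four. The middle cycle is
  -- cut into pieces of two or three labels, each with a label in the five and one in either
  -- complement; the witnesses name these labels, with `1` or `-1` for a full turn.
  rcases hv with ⟨hv, hv'⟩ | ⟨hv, hv'⟩
  · refine F.isMinorOf_of_arcs hG (p := r) (p' := r + 2) (q := r + 2) (q' := r + 2 + 2)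
      (y₀ := r + 1) (y₁ := r + 4) (y₂ := r + 6) (by omega) (by omega) (by omega) (by omega)
      (by omega) (by omega) (by omega)
      (.inl ⟨r + 1, 0, ?_⟩) (.inr ⟨r + 4, 0, ?_⟩) (.inl ⟨r + 7, -1, ?_⟩)
      ⟨r + 3, 0, ?_⟩ ⟨r + 4, 0, ?_⟩ ⟨r + 6, 0, ?_⟩ ⟨r + 1, 1, ?_⟩ ⟨r + 5, 0, ?_⟩ ⟨r + 6, 0, ?_⟩
      ((key _ _ _).1 hu) ((key _ _ _).2 hu')
      ((key _ _ _).1 (by rwa [sub_add_eq_sub_sub])) ((key _ _ _).2 (by rwa [sub_add_eq_sub_sub]))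
      hab hab' <;> omega
  · refine F.isMinorOf_of_arcs hG (p := r) (p' := r + 2) (q := r - 2) (q' := r - 2 + 2)
      (y₀ := r + 2) (y₁ := r + 4) (y₂ := r + 6) (by omega) (by omega) (by omega) (by omega)
      (by omega) (by omega) (by omega)
      (.inl ⟨r + 2, 0, ?_⟩) (.inr ⟨r + 5, -1, ?_⟩) (.inl ⟨r + 7, -1, ?_⟩)
      ⟨r + 3, 0, ?_⟩ ⟨r + 4, 0, ?_⟩ ⟨r + 6, 0, ?_⟩ ⟨r + 2, 0, ?_⟩ ⟨r + 4, 0, ?_⟩ ⟨r + 8, -1, ?_⟩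
      ((key _ _ _).1 hu) ((key _ _ _).2 hu')
      ((key _ _ _).1 (by rwa [← sub_add])) ((key _ _ _).2 (by rwa [← sub_add]))
      hab hab' <;> omega

/-! ### Separating the ends of the additional edges -/

/-- `WellSeparated` for labels modulo `7`. -/
def wellSeparatedMod (u v u' v' : ZMod 7) : Prop :=
  ∃ r : ZMod 7, (u - r).val ≤ 2 ∧ 3 ≤ (u' - r).val ∧
    ((v - r - 2).val ≤ 2 ∧ 3 ≤ (v' - r - 2).val ∨ (v - r + 2).val ≤ 2 ∧ 3 ≤ (v' - r + 2).val)

instance (u v u' v' : ZMod 7) : Decidable (wellSeparatedMod u v u' v') :=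
  inferInstanceAs (Decidable (∃ _ : ZMod 7, _))

/-- Separation is invariant under a common rotation of the labels, so the first label can be taken
to be 0 in the finite checks. -/
lemma wellSeparated_of_mod {u v u' v' : ℤ} (s : ℤ)
    (h : wellSeparatedMod (u - s : ℤ) (v - s : ℤ) (u' - s : ℤ) (v' - s : ℤ)) :
    WellSeparated u v u' v' := by
  obtain ⟨r, h⟩ := h
  have key : ∀ w t : ℤ, ((((w - s : ℤ) : ZMod 7) - r + (t : ZMod 7)).val : ℤ) =
      (w - (s + r.val) + t) % 7 := by
    intro w t
    have := ZMod.val_intCast (n := 7) (w - (s + r.val) + t)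
    rw [Nat.cast_ofNat] at this
    rw [← this]
    congr 2
    push_cast
    rw [ZMod.natCast_zmod_val]
    ring
  have k0 : ∀ w : ℤ, ((((w - s : ℤ) : ZMod 7) - r).val : ℤ) = (w - (s + r.val)) % 7 := by
    intro w
    simpa using key w 0
  have k2 : ∀ w : ℤ, ((((w - s : ℤ) : ZMod 7) - r - 2).val : ℤ) = (w - (s + r.val) - 2) % 7 := by
    intro w
    simpa [sub_eq_add_neg] using key w (-2)
  have k2' : ∀ w : ℤ, ((((w - s : ℤ) : ZMod 7) - r + 2).val : ℤ) = (w - (s + r.val) + 2) % 7 := by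
    intro w
    simpa using key w 2
  refine ⟨s + r.val, ?_⟩
  rw [← k0, ← k0, ← k2, ← k2, ← k2', ← k2']
  exact_mod_cast h

/-- Here `0` and `d` are labels on the first cycle, `v` and `v + e` on the third. The bounds on `d`
and `e` are the gaps that distances 2 and 1 provide. -/
lemma wellSeparatedMod_of_gap : ∀ d v e : ZMod 7, d = 3 ∨ d = 4 → 2 ≤ e.val → e.val ≤ 5 →
    wellSeparatedMod 0 v d (v + e) ∨ wellSeparatedMod d (v + e) 0 v := by
  decide +kernel

/-- A gap of one on the third cycle need not suffice for two edges. The third edge has an arbitrary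
label `w` at one end and a label other than `v` and `v + 1` at the other. -/
lemma wellSeparatedMod_of_adjacent : ∀ d v e w : ZMod 7, d = 3 ∨ d = 4 → 2 ≤ e.val →
    (wellSeparatedMod 0 v d (v + 1) ∨ wellSeparatedMod d (v + 1) 0 v) ∨
    (wellSeparatedMod 0 v w (v + e) ∨ wellSeparatedMod w (v + e) 0 v) ∨
    (wellSeparatedMod d (v + 1) w (v + e) ∨ wellSeparatedMod w (v + e) d (v + 1)) := by
  decide +kernel

/-- The ends of two edges are well separated, in one of the two orders. -/
def WellSeparatedPair (u v u' v' : ℤ) : Prop := WellSeparated u v u' v' ∨ WellSeparated u' v' u v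

lemma intCast_eq_of_emod {z : ℤ} {m : ℕ} (h : z % 7 = m) : (z : ZMod 7) = m := by
  have : ((z : ℤ) : ZMod 7) = ((m : ℤ) : ZMod 7) :=
    (ZMod.intCast_eq_intCast_iff z m 7).2 (by
      rw [Int.ModEq, ← h]
      simp)
  simpa using this

lemma wellSeparatedPair_of_gap {u₁ u₂ v₁ v₂ : ℤ} (hu : (u₂ - u₁) % 7 = 3 ∨ (u₂ - u₁) % 7 = 4)
    (hv : 2 ≤ (v₂ - v₁) % 7) (hv' : (v₂ - v₁) % 7 ≤ 5) : WellSeparatedPair u₁ v₁ u₂ v₂ := by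
  have hd : ((u₂ - u₁ : ℤ) : ZMod 7) = 3 ∨ ((u₂ - u₁ : ℤ) : ZMod 7) = 4 :=
    hu.imp (intCast_eq_of_emod (m := 3)) (intCast_eq_of_emod (m := 4))
  have he := ZMod.val_intCast (n := 7) (v₂ - v₁)
  rw [Nat.cast_ofNat] at he
  have h := wellSeparatedMod_of_gap (u₂ - u₁ : ℤ) (v₁ - u₁ : ℤ) (v₂ - v₁ : ℤ) hd (by omega) (by omega)
  have e1 : (0 : ZMod 7) = (u₁ - u₁ : ℤ) := by simp
  have e2 : ((v₁ - u₁ : ℤ) : ZMod 7) + (v₂ - v₁ : ℤ) = (v₂ - u₁ : ℤ) := by push_cast; ring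
  rw [e1, e2] at h
  exact h.imp (wellSeparated_of_mod _) (wellSeparated_of_mod _)

lemma wellSeparatedPair_of_adjacent {u₁ u₂ u₃ v₁ v₂ v₃ : ℤ}
    (hu : (u₂ - u₁) % 7 = 3 ∨ (u₂ - u₁) % 7 = 4)
    (hv : v₂ = v₁ + 1) (hv₃ : 2 ≤ (v₃ - v₁) % 7) :
    WellSeparatedPair u₁ v₁ u₂ v₂ ∨ WellSeparatedPair u₁ v₁ u₃ v₃ ∨
      WellSeparatedPair u₂ v₂ u₃ v₃ := by
  have hd : ((u₂ - u₁ : ℤ) : ZMod 7) = 3 ∨ ((u₂ - u₁ : ℤ) : ZMod 7) = 4 :=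
    hu.imp (intCast_eq_of_emod (m := 3)) (intCast_eq_of_emod (m := 4))
  have he := ZMod.val_intCast (n := 7) (v₃ - v₁)
  rw [Nat.cast_ofNat] at he
  have h := wellSeparatedMod_of_adjacent (u₂ - u₁ : ℤ) (v₁ - u₁ : ℤ) (v₃ - v₁ : ℤ) (u₃ - u₁ : ℤ) hd
    (by omega)
  have e1 : (0 : ZMod 7) = (u₁ - u₁ : ℤ) := by simp
  have e2 : ((v₁ - u₁ : ℤ) : ZMod 7) + 1 = (v₂ - u₁ : ℤ) := by rw [hv]; push_cast; ring
  have e3 : ((v₁ - u₁ : ℤ) : ZMod 7) + (v₃ - v₁ : ℤ) = (v₃ - u₁ : ℤ) := by push_cast; ring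
  rw [e1, e2, e3] at h
  exact h.imp (Or.imp (wellSeparated_of_mod _) (wellSeparated_of_mod _))
    (Or.imp (Or.imp (wellSeparated_of_mod _) (wellSeparated_of_mod _))
      (Or.imp (wellSeparated_of_mod _) (wellSeparated_of_mod _)))

/-! ### Choosing labels -/

/-- `σ` gives the positions of seven marks on a cycle of length `N`. -/
structure IsMarking (N : ℤ) (σ : ℤ → ℤ) : Prop where
  pos : 0 < N
  mono : StrictMono σ
  add : ∀ i n : ℤ, σ (i + n * 7) = σ i + n * N

/-- `φ` labels the positions on a cycle with marks at `σ`. -/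
structure IsLabelling (N : ℤ) (σ φ : ℤ → ℤ) : Prop where
  mono : Monotone φ
  add : ∀ x n : ℤ, φ (x + n * N) = φ x + n * 7
  mark : ∀ i, φ (σ i) = i

namespace IsMarking

variable {N : ℤ} {σ : ℤ → ℤ}

/-- `i` and `i'` index the last mark up to `x` and the first mark from `x` on; they are the labels
that a monotone labelling may give to `x`. -/
lemma exists_floor_ceil (h : IsMarking N σ) (x : ℤ) : ∃ i i' : ℤ, i ≤ i' ∧ i' ≤ i + 1 ∧
    (∀ j, σ j ≤ x ↔ j ≤ i) ∧ ∀ j, x ≤ σ j ↔ i' ≤ j := by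
  have hN := h.pos
  obtain ⟨i, hi, hmax⟩ := Int.exists_greatest_of_bdd (P := fun i => σ i ≤ x)
    ⟨0 + |x - σ 0| * 7, fun z hz => h.mono.le_iff_le.1 (hz.trans (by
      rw [h.add]
      have := le_abs_self (x - σ 0)
      have := abs_nonneg (x - σ 0)
      nlinarith))⟩
    ⟨0 + (-|x - σ 0|) * 7, by
      rw [h.add]
      have := neg_abs_le (x - σ 0)
      have := abs_nonneg (x - σ 0)
      nlinarith⟩
  have hle : ∀ j, σ j ≤ x ↔ j ≤ i := fun j =>
    ⟨hmax j, fun hj => (h.mono.monotone hj).trans hi⟩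
  by_cases hx : σ i = x
  · exact ⟨i, i, le_rfl, by omega, hle, fun j => by rw [← hx, h.mono.le_iff_le]⟩
  · refine ⟨i, i + 1, by omega, le_rfl, hle, fun j => ?_⟩
    have := hle j
    constructor
    · intro hj
      by_contra! hlt
      have h1 : σ j ≤ σ i := h.mono.monotone (by omega)
      omega
    · intro hj
      have : ¬ j ≤ i := by omega
      rw [← hle] at this
      omega

/-- If there are `d` marks on either side between two positions, then the positions can be given
labels with gaps of at least `d + 1`. -/
lemma exists_labelling_of_far (h : IsMarking N σ) {d : ℤ} (hd : d = 1 ∨ d = 2) {α₁ α₂ : ℤ}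
    (h₁ : ∃ i, α₁ < σ i ∧ σ (i + (d - 1)) < α₂)
    (h₂ : ∃ i, α₂ < σ i ∧ σ (i + (d - 1)) < α₁ + N) :
    ∃ φ, IsLabelling N σ φ ∧ d + 1 ≤ φ α₂ - φ α₁ ∧ φ α₂ - φ α₁ ≤ 6 - d := by
  obtain ⟨k, hk, hk'⟩ := h₁
  obtain ⟨l, hl, hl'⟩ := h₂
  have hα : α₁ < α₂ := hk.trans_le ((h.mono.monotone (by omega)).trans hk'.le)
  have hα' : α₂ < α₁ + N := hl.trans_le ((h.mono.monotone (by omega)).trans hl'.le)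
  obtain ⟨i₁, i₁', h11, h12, hf₁, hc₁⟩ := h.exists_floor_ceil α₁
  obtain ⟨i₂, i₂', h21, h22, hf₂, hc₂⟩ := h.exists_floor_ceil α₂
  have e1 : i₁ < k := by
    by_contra! h'
    have := (hf₁ k).2 h'
    omega
  have e2 : k + (d - 1) < i₂' := by
    by_contra! h'
    have := (hc₂ _).2 h'
    omega
  have e3 : i₂ < l := by
    by_contra! h'
    have := (hf₂ l).2 h'
    omega
  have e4 : l + (d - 1) - 7 < i₁' := by
    by_contra! h'
    have := (hc₁ _).2 h'
    have h3 := h.add (l + (d - 1)) (-1)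
    rw [show l + (d - 1) + -1 * 7 = l + (d - 1) - 7 by ring] at h3
    omega
  -- If the inner labels are far enough apart, take them; the marks on the other side bound their
  -- gap from above. Otherwise the inner gap is at most `d`, and the outer labels add at most two,
  -- so their gap is at most `d + 2 ≤ 6 - d`, while the marks in between make it at least `d + 1`.
  obtain ⟨u₁, u₂, a1, a2, a3, a4, a5, a6⟩ : ∃ u₁ u₂, i₁ ≤ u₁ ∧ u₁ ≤ i₁' ∧ i₂ ≤ u₂ ∧ u₂ ≤ i₂' ∧
      d + 1 ≤ u₂ - u₁ ∧ u₂ - u₁ ≤ 6 - d := by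
    by_cases hc : d + 1 ≤ i₂ - i₁'
    · exact ⟨i₁', i₂, by omega, by omega, by omega, by omega, by omega, by omega⟩
    · exact ⟨i₁, i₂', by omega, by omega, by omega, by omega, by omega, by omega⟩
  obtain ⟨φ, hφ, hφN, hφσ, hφα⟩ := exists_labelling h.pos h.mono h.add (α := ![α₁, α₂])
    (u := ![u₁, u₂]) (by simpa [Fin.strictMono_iff_lt_succ] using hα)
    (by have := h.pos; simp [Fin.forall_fin_two]; omega)
    (by simp [Fin.monotone_iff_le_succ]; omega) (by simp [Fin.forall_fin_two]; omega)
    (by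
      simp only [Fin.forall_fin_two, Matrix.cons_val_zero, Matrix.cons_val_one]
      exact ⟨fun i hi => ((hf₁ i).1 hi).trans a1, fun i hi => ((hf₂ i).1 hi).trans a3⟩)
    (by
      simp only [Fin.forall_fin_two, Matrix.cons_val_zero, Matrix.cons_val_one]
      exact ⟨fun i hi => a2.trans ((hc₁ i).1 hi), fun i hi => a4.trans ((hc₂ i).1 hi)⟩)
  have b1 := hφα 0
  have b2 := hφα 1
  simp only [Matrix.cons_val_zero, Matrix.cons_val_one] at b1 b2
  exact ⟨φ, ⟨hφ, hφN, hφσ⟩, by omega, by omega⟩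

/-- Two positions between consecutive marks and a third one elsewhere can be given labels `j`,
`j + 1` and another label. -/
lemma exists_labelling_of_near (h : IsMarking N σ) {β₁ β₂ β₃ j : ℤ} (hβ : β₁ < β₂)
    (h₁ : σ j ≤ β₁) (h₂ : β₂ ≤ σ (j + 1))
    (h₃ : ∀ n : ℤ, σ j ≤ β₃ + n * N → ¬ β₃ + n * N ≤ σ (j + 1)) :
    ∃ φ, IsLabelling N σ φ ∧ φ β₁ = j ∧ φ β₂ = j + 1 ∧ 2 ≤ (φ β₃ - j) % 7 := by
  have hN := h.pos
  -- Full turns move the third position into the period that begins at `σ j`; by `h₃` it then lies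
  -- beyond the mark `j + 1`.
  obtain ⟨n, hn, hn'⟩ : ∃ n : ℤ, σ (j + 1) < β₃ + n * N ∧ β₃ + n * N < σ (j + 7) := by
    refine ⟨-((β₃ - σ j) / N), ?_⟩
    have e1 := Int.emod_add_mul_ediv (β₃ - σ j) N
    have e2 := Int.emod_nonneg (β₃ - σ j) hN.ne'
    have e3 := Int.emod_lt_of_pos (β₃ - σ j) hN
    have e4 : β₃ + -((β₃ - σ j) / N) * N = σ j + (β₃ - σ j) % N := by linarith
    have e5 := h.add j 1
    rw [one_mul, one_mul] at e5
    have := h₃ (-((β₃ - σ j) / N)) (by omega)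
    exact ⟨by omega, by omega⟩
  set γ := β₃ + n * N with hγ
  obtain ⟨i, i', e1, e2, hf, hc⟩ := h.exists_floor_ceil γ
  have f1 : j + 1 ≤ i := (hf _).1 hn.le
  have f2 : i' ≤ j + 7 := (hc _).1 hn'.le
  have f3 : j + 2 ≤ i' := by
    by_contra! h'
    have := (hc (j + 1)).2 (by omega)
    omega
  have f4 : i ≤ j + 6 := by
    by_contra! h'
    have := (hf (j + 7)).2 (by omega)
    omega
  -- Of the labels available for `γ`, one is chosen that avoids `j + 1` and `j + 7`, the latter
  -- being `j` modulo 7.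
  obtain ⟨v, g1, g2, g3, g4⟩ : ∃ v, i ≤ v ∧ v ≤ i' ∧ j + 2 ≤ v ∧ v ≤ j + 6 := by
    by_cases hc : i = j + 1
    · exact ⟨i', by omega, by omega, by omega, by omega⟩
    · exact ⟨i, by omega, by omega, by omega, by omega⟩
  have hper := h.add j 1
  rw [one_mul, one_mul] at hper
  have hlt : ∀ a b : ℤ, σ a < σ b ↔ a < b := fun a b => h.mono.lt_iff_lt
  obtain ⟨φ, hφ, hφN, hφσ, hφα⟩ := exists_labelling h.pos h.mono h.add (α := ![β₁, β₂, γ])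
    (u := ![j, j + 1, v])
    (by
      rw [Fin.strictMono_iff_lt_succ]
      simp only [Fin.forall_fin_two]
      exact ⟨hβ, h₂.trans_lt hn⟩)
    (by
      simp only [Fin.forall_fin_succ, IsEmpty.forall_iff, and_true, Matrix.cons_val_zero,
        Matrix.cons_val_succ]
      omega)
    (by
      rw [Fin.monotone_iff_le_succ]
      simp only [Fin.forall_fin_two]
      exact ⟨show j ≤ j + 1 by omega, show j + 1 ≤ v by omega⟩)
    (by
      simp only [Fin.forall_fin_succ, IsEmpty.forall_iff, and_true, Matrix.cons_val_zero,
        Matrix.cons_val_succ]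
      omega)
    (by
      simp only [Fin.forall_fin_succ, IsEmpty.forall_iff, and_true, Matrix.cons_val_zero,
        Matrix.cons_val_succ]
      refine ⟨fun i hi => ?_, fun i hi => ?_, fun i hi => ((hf i).1 hi).trans g1⟩
      · have := (hlt i (j + 1)).1 (by omega)
        omega
      · exact h.mono.le_iff_le.1 (hi.trans h₂))
    (by
      simp only [Fin.forall_fin_succ, IsEmpty.forall_iff, and_true, Matrix.cons_val_zero,
        Matrix.cons_val_succ]
      refine ⟨fun i hi => h.mono.le_iff_le.1 (h₁.trans hi), fun i hi => ?_,
        fun i hi => g2.trans ((hc i).1 hi)⟩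
      have := (hlt j i).1 (by omega)
      omega)
  have b1 := hφα 0
  have b2 := hφα 1
  have b3 : φ γ = v := hφα 2
  simp only [Matrix.cons_val_zero, Matrix.cons_val_one] at b1 b2
  rw [hγ, hφN] at b3
  exact ⟨φ, ⟨hφ, hφN, hφσ⟩, b1, b2, by omega⟩

lemma exists_labelling' (h : IsMarking N σ) : ∃ φ, IsLabelling N σ φ := by
  obtain ⟨φ, hφ, hφN, hφσ, -⟩ := exists_labelling h.pos h.mono h.add (m := 0) (α := ![]) (u := ![])
    (fun i => i.elim0) (fun i => i.elim0) (fun i => i.elim0) (fun i => i.elim0) (fun i => i.elim0)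
    (fun i => i.elim0)
  exact ⟨φ, hφ, hφN, hφσ⟩

end IsMarking

/-! ### Cycles marked by the paths -/

/-- The residue of an integer modulo `7`. -/
def residue (i : ℤ) : Fin 7 := ⟨(i % 7).toNat, by omega⟩

lemma residue_add (i n : ℤ) : residue (i + n * 7) = residue i := by
  ext
  simp only [residue]
  omega

lemma residue_natCast (i : Fin 7) : residue (i : ℕ) = i := by
  ext
  have := i.2
  simp only [residue]
  omega

lemma residue_eq_iff {i j : ℤ} : residue i = residue j ↔ ∃ n : ℤ, i = j + n * 7 := by
  constructor
  · intro h
    have := congrArg Fin.val h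
    simp only [residue] at this
    exact ⟨i / 7 - j / 7, by omega⟩
  · rintro ⟨n, rfl⟩
    exact residue_add j n

namespace SimpleGraph.Walk

section Interior

variable {V : Type*} {G : SimpleGraph V}

/-- The interior of a path. -/
lemma IsPath.interior_connected {s t : V} {p : G.Walk s t} (hp : p.IsPath)
    (hm : ∃ m ∈ p.support, m ≠ s ∧ m ≠ t) :
    (G.induce {v | v ∈ p.support ∧ v ≠ s ∧ v ≠ t}).Connected ∧
      (∃ v, (v ∈ p.support ∧ v ≠ s ∧ v ≠ t) ∧ G.Adj s v) ∧
      ∃ v, (v ∈ p.support ∧ v ≠ s ∧ v ≠ t) ∧ G.Adj t v := by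
  cases p with
  | nil =>
    obtain ⟨m, hm, h1, -⟩ := hm
    exact absurd (by simpa using hm) h1
  | @cons _ w _ h p =>
    rw [cons_isPath_iff] at hp
    obtain ⟨hp, hs⟩ := hp
    have hsupp : ∀ v, v ∈ p.support ↔ v ∈ p.reverse.support := by simp
    have hp' : p.reverse.IsPath := (isPath_reverse_iff p).2 hp
    -- With the first vertex removed, the rest is reversed and its first vertex removed too: the
    -- interior is the support of a walk, hence connected.
    generalize hq : p.reverse = q at hsupp hp'
    cases q with
    | nil =>
      obtain ⟨m, hm, h1, h2⟩ := hm
      rcases List.mem_cons.1 hm with e | e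
      · exact absurd e h1
      · rw [hsupp] at e
        exact absurd (by simpa using e) h2
    | @cons _ x _ h' q =>
      rw [cons_isPath_iff] at hp'
      have hset : ∀ v, (v ∈ (cons h p).support ∧ v ≠ s ∧ v ≠ t) ↔ v ∈ q.support := by
        intro v
        rw [support_cons, List.mem_cons, hsupp, support_cons, List.mem_cons]
        constructor
        · rintro ⟨e | e | e, h1, h2⟩
          · exact absurd e h1
          · exact absurd e h2
          · exact e
        · intro e
          refine ⟨.inr (.inr e), ?_, ?_⟩
          · rintro rfl
            exact hs ((hsupp _).2 (by rw [support_cons]; exact List.mem_cons_of_mem _ e))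
          · rintro rfl
            exact hp'.2 e
      have hset' : {v | v ∈ (cons h p).support ∧ v ≠ s ∧ v ≠ t} = {v | v ∈ q.support} := Set.ext hset
      rw [hset']
      simp only [hset]
      exact ⟨q.connected_induce_support, ⟨w, q.end_mem_support, h⟩, ⟨x, q.start_mem_support, h'⟩⟩

end Interior

variable {V : Type*} [DecidableEq V] {G : SimpleGraph V} {u : V}

/-- The cycle `C` is run through by `c` so that the vertices `foot 0, …, foot 6` appear in this
order, `foot i` at the positions `σ j` with `j` congruent to `i`. -/
structure IsMarkedBy (C : G.Walk u u) (foot : Fin 7 → V) (c : ℤ → V) (σ : ℤ → ℤ) : Prop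
    extends IsMetricParam C c where
  marking : IsMarking C.length σ
  c_mark : ∀ i, c (σ i) = foot (residue i)

namespace IsMarkedBy

variable {C : G.Walk u u} {foot : Fin 7 → V} {c : ℤ → V} {σ : ℤ → ℤ}

lemma exists_mark_of_mem (h : C.IsMarkedBy foot c σ) {r : ℤ}
    (hr : c r ∈ Finset.univ.image foot) : ∃ i, σ i = r := by
  obtain ⟨i, -, hi⟩ := Finset.mem_image.1 hr
  have e : c r = c (σ (i : ℕ)) := by rw [h.c_mark, residue_natCast, hi]
  obtain ⟨n, rfl⟩ := h.eq_add e
  exact ⟨_, h.marking.add _ n⟩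

lemma exists_mark_of_card (h : C.IsMarkedBy foot c σ) {α β : ℤ}
    (hcard : 1 ≤ ((Finset.Ioo α β).image c ∩ Finset.univ.image foot).card) :
    ∃ i, α < σ i ∧ σ i < β := by
  obtain ⟨v, hv⟩ := Finset.card_pos.1 hcard
  obtain ⟨hv1, hv2⟩ := Finset.mem_inter.1 hv
  obtain ⟨r, hr, rfl⟩ := Finset.mem_image.1 hv1
  obtain ⟨i, rfl⟩ := h.exists_mark_of_mem hv2
  exact ⟨i, Finset.mem_Ioo.1 hr⟩

lemma exists_two_marks_of_card (h : C.IsMarkedBy foot c σ) {α β : ℤ}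
    (hcard : 2 ≤ ((Finset.Ioo α β).image c ∩ Finset.univ.image foot).card) :
    ∃ i, α < σ i ∧ σ (i + 1) < β := by
  obtain ⟨v, hv, w, hw, hvw⟩ := Finset.one_lt_card.1 hcard
  obtain ⟨hv1, hv2⟩ := Finset.mem_inter.1 hv
  obtain ⟨r, hr, rfl⟩ := Finset.mem_image.1 hv1
  obtain ⟨i, rfl⟩ := h.exists_mark_of_mem hv2
  obtain ⟨hw1, hw2⟩ := Finset.mem_inter.1 hw
  obtain ⟨r', hr', rfl⟩ := Finset.mem_image.1 hw1
  obtain ⟨i', rfl⟩ := h.exists_mark_of_mem hw2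
  have hne : i ≠ i' := fun e => hvw (by rw [e])
  rw [Finset.mem_Ioo] at hr hr'
  rcases lt_or_gt_of_ne hne with hlt | hlt
  · exact ⟨i, hr.1, (h.marking.mono.monotone (by omega)).trans_lt hr'.2⟩
  · exact ⟨i', hr'.1, (h.marking.mono.monotone (by omega)).trans_lt hr.2⟩

lemma card_eq_zero_iff (h : C.IsMarkedBy foot c σ) {α β : ℤ} :
    ((Finset.Ioo α β).image c ∩ Finset.univ.image foot).card = 0 ↔
      ∀ i, α < σ i → ¬ σ i < β := by
  constructor
  · intro h0 i h1 h2
    rw [Finset.card_eq_zero] at h0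
    have : c (σ i) ∈ (Finset.Ioo α β).image c ∩ Finset.univ.image foot :=
      Finset.mem_inter.2 ⟨Finset.mem_image_of_mem _ (Finset.mem_Ioo.2 ⟨h1, h2⟩),
        by rw [h.c_mark]; exact Finset.mem_image_of_mem _ (Finset.mem_univ _)⟩
    rw [h0] at this
    exact absurd this (Finset.notMem_empty _)
  · intro h0
    by_contra hne
    obtain ⟨i, h1, h2⟩ := h.exists_mark_of_card (Nat.one_le_iff_ne_zero.2 hne)
    exact h0 i h1 h2

/-- Positions of two vertices of the cycle, the second one less than one turn after the first. -/
lemma exists_positions (h : C.IsMarkedBy foot c σ) {x y : V} (hx : x ∈ C.support)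
    (hy : y ∈ C.support) : ∃ α β : ℤ, c α = x ∧ c β = y ∧ α ≤ β ∧ β < α + C.length := by
  have hN := h.marking.pos
  obtain ⟨α, rfl⟩ := (h.mem_iff x).1 hx
  obtain ⟨β, rfl⟩ := (h.mem_iff y).1 hy
  refine ⟨α, β + (-((β - α) / C.length)) * C.length, rfl, h.periodic _ _, ?_⟩
  have e1 := Int.emod_add_mul_ediv (β - α) C.length
  have e2 := Int.emod_nonneg (β - α) hN.ne'
  have e3 := Int.emod_lt_of_pos (β - α) hN
  have e4 : β + (-((β - α) / C.length)) * C.length = α + (β - α) % C.length := by linarith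
  omega

/-- No mark lies strictly between two positions of a closed segment with consecutive marks as ends.
The contrapositive use is to place a vertex at positive distance outside such a segment. -/
lemma cycleDist_eq_zero (h : C.IsMarkedBy foot c σ) {α β j : ℤ} (hα : σ j ≤ α)
    (hα' : α ≤ σ (j + 1)) (hβ : σ j ≤ β) (hβ' : β ≤ σ (j + 1)) {x y : V} (hxα : c α = x)
    (hyβ : c β = y) (hx : x ∈ C.support) (hy : y ∈ C.support) :
    cycleDist C (Finset.univ.image foot) x y hx hy = 0 := by
  have hper := h.marking.add j 1
  rw [one_mul, one_mul] at hper
  have hlt : σ (j + 1) < σ (j + 7) := h.marking.mono (by omega)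
  have hno : ∀ i, σ j < σ i → ¬ σ i < σ (j + 1) := fun i h1 h2 => by
    rw [h.marking.mono.lt_iff_lt] at h1 h2
    omega
  rcases le_or_gt α β with hab | hab
  · rw [h.dist_eq hab (by omega) _ hxα hyβ, (h.card_eq_zero_iff (α := α) (β := β)).2
      (fun i h1 h2 => hno i (by omega) (by omega))]
    simp
  · rw [h.dist_eq (α := α) (β := β + 1 * C.length) (by omega) (by omega) _ hxα
      (by rw [h.periodic, hyβ]), (h.card_eq_zero_iff (α := β + 1 * C.length)).2]
    · simp
    · intro i h1 h2
      have e := h.marking.add i (-1)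
      refine hno (i + -1 * 7) ?_ ?_ <;> omega

lemma exists_labelling_of_le_dist (h : C.IsMarkedBy foot c σ) {d : ℕ} (hd : d = 1 ∨ d = 2) {x y : V}
    (hx : x ∈ C.support) (hy : y ∈ C.support)
    (hdist : d ≤ cycleDist C (Finset.univ.image foot) x y hx hy) :
    ∃ φ α β, IsLabelling C.length σ φ ∧ c α = x ∧ c β = y ∧ (d : ℤ) + 1 ≤ φ β - φ α ∧
      φ β - φ α ≤ 6 - d := by
  obtain ⟨α, β, hα, hβ, h1, h2⟩ := h.exists_positions hx hy
  rw [h.dist_eq h1 h2 _ hα hβ, le_min_iff] at hdist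
  obtain ⟨φ, hφ, hlo, hhi⟩ := h.marking.exists_labelling_of_far (d := d) (α₁ := α) (α₂ := β)
    (by omega)
    (by
      rcases hd with rfl | rfl
      · simpa using h.exists_mark_of_card hdist.1
      · simpa using h.exists_two_marks_of_card hdist.1)
    (by
      rcases hd with rfl | rfl
      · simpa using h.exists_mark_of_card hdist.2
      · simpa using h.exists_two_marks_of_card hdist.2)
  exact ⟨φ, α, β, hφ, hα, hβ, hlo, hhi⟩

/-- One of the segments between `x` and `y` is free of marks, so both vertices lie in a closed
segment between consecutive marks and can take the labels of its ends. If `z` lay there too, it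
would have distance 0 from both, against `hfar`. -/
lemma exists_labelling_of_dist_eq_zero (h : C.IsMarkedBy foot c σ) {x y z : V} (hxy : x ≠ y)
    (hx : x ∈ C.support) (hy : y ∈ C.support) (hz : z ∈ C.support)
    (hdist : cycleDist C (Finset.univ.image foot) x y hx hy = 0)
    (hfar : 1 ≤ cycleDist C (Finset.univ.image foot) x z hx hz ∨
      1 ≤ cycleDist C (Finset.univ.image foot) y z hy hz) :
    ∃ φ α β γ, IsLabelling C.length σ φ ∧ c α = x ∧ c β = y ∧ c γ = z ∧
      (φ β = φ α + 1 ∧ 2 ≤ (φ γ - φ α) % 7 ∨ φ α = φ β + 1 ∧ 2 ≤ (φ γ - φ β) % 7) := by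
  obtain ⟨α, β, hα, hβ, h1, h2⟩ := h.exists_positions hx hy
  obtain ⟨γ, hγ⟩ := (h.mem_iff z).1 hz
  have hne : α ≠ β := fun e => hxy (by rw [← hα, ← hβ, e])
  rw [h.dist_eq h1 h2 _ hα hβ] at hdist
  have near : ∀ {α β : ℤ}, α < β → (∀ i, α < σ i → ¬ σ i < β) →
      ∃ j, σ j ≤ α ∧ β ≤ σ (j + 1) ∧ α ≤ σ (j + 1) ∧ σ j ≤ β := by
    intro α β hlt hno
    obtain ⟨j, -, -, -, hf, -⟩ := h.marking.exists_floor_ceil α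
    have e1 := (hf j).2 le_rfl
    have e2 : α < σ (j + 1) := by
      by_contra! hle
      have := (hf _).1 hle
      omega
    have := hno _ e2
    exact ⟨j, e1, by omega, by omega, by omega⟩
  have out : ∀ {α β j : ℤ}, c α = x ∨ c α = y → c β = x ∨ c β = y → c α ≠ c β → σ j ≤ α →
      α ≤ σ (j + 1) → σ j ≤ β → β ≤ σ (j + 1) →
      ∀ n : ℤ, σ j ≤ γ + n * C.length → ¬ γ + n * C.length ≤ σ (j + 1) := by
    intro α β j hα hβ hαβ k1 k2 k3 k4 n k5 k6
    have hγ' : c (γ + n * C.length) = z := by rw [h.periodic, hγ]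
    have : ∃ α', c α' = x ∧ σ j ≤ α' ∧ α' ≤ σ (j + 1) := by
      rcases hα with hα | hα
      · exact ⟨α, hα, k1, k2⟩
      · exact ⟨β, hβ.resolve_right fun hβ => hαβ (hα.trans hβ.symm), k3, k4⟩
    obtain ⟨α', ha, ha1, ha2⟩ := this
    have : ∃ β', c β' = y ∧ σ j ≤ β' ∧ β' ≤ σ (j + 1) := by
      rcases hα with hα | hα
      · exact ⟨β, hβ.resolve_left fun hβ => hαβ (hα.trans hβ.symm), k3, k4⟩
      · exact ⟨α, hα, k1, k2⟩
    obtain ⟨β', hb, hb1, hb2⟩ := this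
    rcases hfar with hfar | hfar
    · rw [h.cycleDist_eq_zero ha1 ha2 k5 k6 ha hγ'] at hfar
      omega
    · rw [h.cycleDist_eq_zero hb1 hb2 k5 k6 hb hγ'] at hfar
      omega
  rcases min_eq_iff.1 hdist with ⟨h0, -⟩ | ⟨h0, -⟩
  · obtain ⟨j, k1, k2, k3, k4⟩ := near (show α < β by omega) (h.card_eq_zero_iff.1 h0)
    obtain ⟨φ, hφ, e1, e2, e3⟩ := h.marking.exists_labelling_of_near (show α < β by omega) k1 k2
      (out (.inl hα) (.inr hβ) (by rwa [hα, hβ]) k1 k3 k4 k2)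
    exact ⟨φ, α, β, γ, hφ, hα, hβ, hγ, .inl ⟨by omega, by rwa [e1]⟩⟩
  -- The free segment leads from `y` on to `x`, so `x` is taken one turn later and comes second.
  · have hα' : c (α + C.length) = x := by
      rw [← hα, ← h.periodic α 1, one_mul]
    obtain ⟨j, k1, k2, k3, k4⟩ := near (show β < α + C.length by omega) (h.card_eq_zero_iff.1 h0)
    obtain ⟨φ, hφ, e1, e2, e3⟩ := h.marking.exists_labelling_of_near
      (show β < α + C.length by omega) k1 k2
      (out (.inr hβ) (.inl hα') (by rw [hα', hβ]; exact hxy.symm) k1 k3 k4 k2)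
    exact ⟨φ, α + C.length, β, γ, hφ, hα', hβ, hγ, .inr ⟨by omega, by rwa [e1]⟩⟩

/-- The labelled cycle given by a labelling of a marked cycle. -/
def toLabelledCycle (h : C.IsMarkedBy foot c σ) {φ : ℤ → ℤ} (hφ : IsLabelling C.length σ φ) :
    LabelledCycle G where
  c := c
  N := C.length
  φ := φ
  σ := σ
  c_add := h.periodic
  eq_add := h.eq_add
  adj := h.adj
  φ_mono := hφ.mono
  φ_add := hφ.add
  φ_σ := hφ.mark

end IsMarkedBy

end SimpleGraph.Walk

/-! ### Both statements for seven paths. -/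

section Core

open SimpleGraph.Walk

variable {V : Type*} [DecidableEq V] {G : SimpleGraph V} {w₁ w₂ w₃ : V}
  {C₁ : G.Walk w₁ w₁} {C₂ : G.Walk w₂ w₂} {C₃ : G.Walk w₃ w₃} {s m t : Fin 7 → V}
  {c₁ c₂ c₃ : ℤ → V} {σ₁ σ₂ σ₃ φ₁ φ₂ φ₃ : ℤ → ℤ}

/-- The frame formed by three disjoint cycles that seven disjoint paths meet in the same order. -/
def frameOfMarkedCycles (h₁ : C₁.IsMarkedBy s c₁ σ₁) (h₂ : C₂.IsMarkedBy m c₂ σ₂)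
    (h₃ : C₃.IsMarkedBy t c₃ σ₃) (hφ₁ : IsLabelling C₁.length σ₁ φ₁)
    (hφ₂ : IsLabelling C₂.length σ₂ φ₂) (hφ₃ : IsLabelling C₃.length σ₃ φ₃)
    (hC₁₂ : C₁.support.Disjoint C₂.support) (hC₁₃ : C₁.support.Disjoint C₃.support)
    (hC₂₃ : C₂.support.Disjoint C₃.support) (P : ∀ i, G.Walk (s i) (t i))
    (hP : ∀ i, (P i).IsPath)
    (hPP : ∀ i i', i ≠ i' → (P i).support.Disjoint (P i').support)
    (hP₁ : ∀ i v, v ∈ (P i).support → v ∈ C₁.support → v = s i)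
    (hP₂ : ∀ i v, v ∈ (P i).support → v ∈ C₂.support → v = m i)
    (hP₃ : ∀ i v, v ∈ (P i).support → v ∈ C₃.support → v = t i)
    (hm : ∀ i, m i ∈ (P i).support) : Frame G :=
  have mem₁ : ∀ x, c₁ x ∈ C₁.support := fun x => (h₁.mem_iff _).2 ⟨x, rfl⟩
  have mem₂ : ∀ x, c₂ x ∈ C₂.support := fun x => (h₂.mem_iff _).2 ⟨x, rfl⟩
  have mem₃ : ∀ x, c₃ x ∈ C₃.support := fun x => (h₃.mem_iff _).2 ⟨x, rfl⟩
  have hms : ∀ i : ℤ, m (residue i) ≠ s (residue i) := fun i e =>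
    hC₁₂ (mem₁ (σ₁ i)) (by rw [h₁.c_mark, ← e, ← h₂.c_mark]; exact mem₂ _)
  have hmt : ∀ i : ℤ, m (residue i) ≠ t (residue i) := fun i e =>
    hC₂₃ (mem₂ (σ₂ i)) (by rw [h₂.c_mark, e, ← h₃.c_mark]; exact mem₃ _)
  have hQ_int := fun i : ℤ => (hP (residue i)).interior_connected ⟨_, hm _, hms i, hmt i⟩
  { R₁ := h₁.toLabelledCycle hφ₁
    R₂ := h₂.toLabelledCycle hφ₂
    R₃ := h₃.toLabelledCycle hφ₃
    Q := fun i => {v | v ∈ (P (residue i)).support ∧ v ≠ s (residue i) ∧ v ≠ t (residue i)}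
    disj₁₂ := fun x y e => hC₁₂ (mem₁ x) (by rw [show c₁ x = c₂ y from e]; exact mem₂ y)
    disj₁₃ := fun x y e => hC₁₃ (mem₁ x) (by rw [show c₁ x = c₃ y from e]; exact mem₃ y)
    disj₂₃ := fun x y e => hC₂₃ (mem₂ x) (by rw [show c₂ x = c₃ y from e]; exact mem₃ y)
    Q_add := fun i n => by rw [residue_add]
    Q_connected := fun i => (hQ_int i).1
    Q_disj := fun i j v hi hj => by
      rw [← residue_eq_iff]
      by_contra hne
      exact hPP _ _ hne hi.1 hj.1
    Q_disj₁ := fun i x hx => hx.2.1 (hP₁ _ _ hx.1 (mem₁ x))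
    Q_disj₃ := fun i x hx => hx.2.2 (hP₃ _ _ hx.1 (mem₃ x))
    mem_Q₂ := fun i => by
      change c₂ (σ₂ i) ∈ _
      rw [h₂.c_mark]
      exact ⟨hm _, hms i, hmt i⟩
    Q_inter₂ := fun i x hx => by
      change c₂ x = c₂ (σ₂ i)
      rw [h₂.c_mark]
      exact hP₂ _ _ hx.1 (mem₂ x)
    adj₁ := fun i => by
      change ∃ v ∈ _, G.Adj (c₁ (σ₁ i)) v
      rw [h₁.c_mark]
      exact (hQ_int i).2.1
    adj₃ := fun i => by
      change ∃ v ∈ _, G.Adj (c₃ (σ₃ i)) v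
      rw [h₃.c_mark]
      exact (hQ_int i).2.2 }

/-- The theorem for seven paths that meet the three cycles in the same cyclic order. -/
theorem isMinorOf_of_markedCycles (h₁ : C₁.IsMarkedBy s c₁ σ₁) (h₂ : C₂.IsMarkedBy m c₂ σ₂)
    (h₃ : C₃.IsMarkedBy t c₃ σ₃)
    (hC₁₂ : C₁.support.Disjoint C₂.support) (hC₁₃ : C₁.support.Disjoint C₃.support)
    (hC₂₃ : C₂.support.Disjoint C₃.support) (P : ∀ i, G.Walk (s i) (t i))
    (hP : ∀ i, (P i).IsPath)
    (hPP : ∀ i i', i ≠ i' → (P i).support.Disjoint (P i').support)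
    (hP₁ : ∀ i v, v ∈ (P i).support → v ∈ C₁.support → v = s i)
    (hP₂ : ∀ i v, v ∈ (P i).support → v ∈ C₂.support → v = m i)
    (hP₃ : ∀ i v, v ∈ (P i).support → v ∈ C₃.support → v = t i)
    (hm : ∀ i, m i ∈ (P i).support)
    {a₁ a₂ b₁ b₂ : V} (ha₁ : a₁ ∈ C₁.support) (ha₂ : a₂ ∈ C₁.support)
    (hb₁ : b₁ ∈ C₃.support) (hb₂ : b₂ ∈ C₃.support) (hb : b₁ ≠ b₂)
    (ha : 2 ≤ cycleDist C₁ (Finset.univ.image s) a₁ a₂ ha₁ ha₂) :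
    (1 ≤ cycleDist C₃ (Finset.univ.image t) b₁ b₂ hb₁ hb₂ → ∀ G' : SimpleGraph V, G ≤ G' →
      G'.Adj a₁ b₁ → G'.Adj a₂ b₂ → (SimpleGraph.completeGraph (Fin 6)).IsMinorOf G') ∧
    (cycleDist C₃ (Finset.univ.image t) b₁ b₂ hb₁ hb₂ = 0 →
      ∀ (a₃ b₃ : V) (_ : a₃ ∈ C₁.support) (hb₃ : b₃ ∈ C₃.support),
        (1 ≤ cycleDist C₃ (Finset.univ.image t) b₁ b₃ hb₁ hb₃ ∨
          1 ≤ cycleDist C₃ (Finset.univ.image t) b₂ b₃ hb₂ hb₃) →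
        ∀ G' : SimpleGraph V, G ≤ G' → G'.Adj a₁ b₁ → G'.Adj a₂ b₂ → G'.Adj a₃ b₃ →
          (SimpleGraph.completeGraph (Fin 6)).IsMinorOf G') := by
  obtain ⟨φ₁, α₁, α₂, hφ₁, rfl, rfl, hu, hu'⟩ := h₁.exists_labelling_of_le_dist (.inr rfl) ha₁ ha₂ ha
  obtain ⟨φ₂, hφ₂⟩ := h₂.marking.exists_labelling'
  have minor : ∀ {φ₃ : ℤ → ℤ} (_ : IsLabelling C₃.length σ₃ φ₃) {α β α' β' : ℤ},
      WellSeparatedPair (φ₁ α) (φ₃ β) (φ₁ α') (φ₃ β') → ∀ G' : SimpleGraph V, G ≤ G' →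
      G'.Adj (c₁ α) (c₃ β) → G'.Adj (c₁ α') (c₃ β') →
      (SimpleGraph.completeGraph (Fin 6)).IsMinorOf G' := by
    intro φ₃ hφ₃ α β α' β' hsep G' hG h h'
    let F := frameOfMarkedCycles h₁ h₂ h₃ hφ₁ hφ₂ hφ₃ hC₁₂ hC₁₃ hC₂₃ P hP hPP hP₁ hP₂ hP₃ hm
    rcases hsep with hsep | hsep
    · exact F.isMinorOf_of_wellSeparated hG hsep h h'
    · exact F.isMinorOf_of_wellSeparated hG hsep h' h
  constructor
  · intro hd G' hG e₁ e₂
    obtain ⟨φ₃, β₁, β₂, hφ₃, rfl, rfl, hv, hv'⟩ :=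
      h₃.exists_labelling_of_le_dist (.inl rfl) hb₁ hb₂ hd
    exact minor hφ₃ (wellSeparatedPair_of_gap (by omega) (by omega) (by omega)) G' hG e₁ e₂
  · intro hd a₃ b₃ ha₃ hb₃ hfar G' hG e₁ e₂ e₃
    obtain ⟨α₃, rfl⟩ := (h₁.mem_iff a₃).1 ha₃
    obtain ⟨φ₃, β₁, β₂, β₃, hφ₃, rfl, rfl, rfl, ⟨hv, hv₃⟩ | ⟨hv, hv₃⟩⟩ :=
      h₃.exists_labelling_of_dist_eq_zero hb hb₁ hb₂ hb₃ hd hfar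
    · rcases wellSeparatedPair_of_adjacent (u₁ := φ₁ α₁) (u₂ := φ₁ α₂) (u₃ := φ₁ α₃) (by omega) hv hv₃
        with h | h | h
      · exact minor hφ₃ h G' hG e₁ e₂
      · exact minor hφ₃ h G' hG e₁ e₃
      · exact minor hφ₃ h G' hG e₂ e₃
    -- Now `b₂` has the smaller label, so the first two edges exchange roles; a difference of 3 or 4
    -- modulo 7 keeps this form under a change of sign.
    · rcases wellSeparatedPair_of_adjacent (u₁ := φ₁ α₂) (u₂ := φ₁ α₁) (u₃ := φ₁ α₃) (by omega) hv hv₃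
        with h | h | h
      · exact minor hφ₃ h G' hG e₂ e₁
      · exact minor hφ₃ h G' hG e₂ e₃
      · exact minor hφ₃ h G' hG e₁ e₃

end Core

/-! ### Reduction to seven paths -/

section Reduction

variable {V : Type*} [DecidableEq V] {G : SimpleGraph V}

/-- Among at least seven distinct reals, seven can be chosen to contain up to seven given ones, and
listed in increasing order. -/
lemma exists_strictMono_seven {k : ℕ} (hk : 7 ≤ k) {x : Fin k → ℝ} (hx : Function.Injective x)
    {I : Finset (Fin k)} (hI : I.card ≤ 7) :
    ∃ e : Fin 7 → Fin k, StrictMono (x ∘ e) ∧ ∀ i ∈ I, ∃ j, e j = i := by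
  obtain ⟨J, hIJ, -, hJ⟩ := Finset.exists_subsuperset_card_eq (Finset.subset_univ I) hI
    (by simpa using hk)
  have hcard : (J.image x).card = 7 := by rw [Finset.card_image_of_injective _ hx, hJ]
  have hmem : ∀ i, ∃ j ∈ J, x j = (J.image x).orderEmbOfFin hcard i := fun i =>
    Finset.mem_image.1 (Finset.orderEmbOfFin_mem _ hcard i)
  choose e he hxe using hmem
  refine ⟨e, fun i j hij => ?_, fun i hi => ?_⟩
  · simp only [Function.comp, hxe]
    exact (OrderEmbedding.strictMono _) hij
  · have : x i ∈ Set.range ((J.image x).orderEmbOfFin hcard) := by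
      rw [Finset.range_orderEmbOfFin]
      exact Finset.mem_coe.2 (Finset.mem_image_of_mem _ (hIJ hi))
    obtain ⟨j, hj⟩ := this
    exact ⟨j, hx (by rw [hxe, hj])⟩

/-- Choose one index for each of `d` vertices in the intersection; a selection of paths that keeps
these indices keeps the bound. -/
lemma exists_index_of_le_card {ι : Type*} [Fintype ι] [DecidableEq ι] {s : ι → V} {X : Finset V}
    {d : ℕ} (h : d ≤ (X ∩ Finset.univ.image s).card) :
    ∃ I : Finset ι, I.card ≤ d ∧ ∀ e : Fin 7 → ι, (∀ i ∈ I, ∃ j, e j = i) →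
      d ≤ (X ∩ Finset.univ.image (s ∘ e)).card := by
  obtain ⟨Y, hY, hcard⟩ := Finset.exists_subset_card_eq h
  have hex : ∀ y : Y, ∃ i, s i = y := fun y => by
    obtain ⟨i, -, hi⟩ := Finset.mem_image.1 (Finset.mem_inter.1 (hY y.2)).2
    exact ⟨i, hi⟩
  choose g hg using hex
  refine ⟨Finset.univ.image g, ?_, fun e he => ?_⟩
  · refine Finset.card_image_le.trans ?_
    rw [Finset.card_univ, Fintype.card_coe, hcard]
  · rw [← hcard]
    refine Finset.card_le_card fun y hy => Finset.mem_inter.2 ⟨(Finset.mem_inter.1 (hY hy)).1, ?_⟩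
    obtain ⟨j, hj⟩ := he (g ⟨y, hy⟩) (Finset.mem_image_of_mem _ (Finset.mem_univ _))
    exact Finset.mem_image.2 ⟨j, Finset.mem_univ _, by simp [hj, hg]⟩

lemma exists_index_of_le_cycleDist {ι : Type*} [Fintype ι] [DecidableEq ι] {s : ι → V} {u : V}
    {C : G.Walk u u} {x y : V} {hx : x ∈ C.support} {hy : y ∈ C.support} {d : ℕ}
    (h : d ≤ cycleDist C (Finset.univ.image s) x y hx hy) :
    ∃ I : Finset ι, I.card ≤ 2 * d ∧ ∀ e : Fin 7 → ι, (∀ i ∈ I, ∃ j, e j = i) →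
      d ≤ cycleDist C (Finset.univ.image (s ∘ e)) x y hx hy := by
  obtain ⟨I, hI, h1⟩ := exists_index_of_le_card (le_min_iff.1 h).1
  obtain ⟨J, hJ, h2⟩ := exists_index_of_le_card (le_min_iff.1 h).2
  refine ⟨I ∪ J, (Finset.card_union_le _ _).trans (by omega), fun e he => le_min ?_ ?_⟩
  · exact h1 e fun i hi => he i (Finset.mem_union_left _ hi)
  · exact h2 e fun i hi => he i (Finset.mem_union_right _ hi)

lemma cycleDist_mono {u : V} {C : G.Walk u u} {S S' : Finset V} (h : S ⊆ S') {x y : V}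
    (hx : x ∈ C.support) (hy : y ∈ C.support) :
    cycleDist C S x y hx hy ≤ cycleDist C S' x y hx hy :=
  min_le_min (Finset.card_le_card (Finset.inter_subset_inter_left h))
    (Finset.card_le_card (Finset.inter_subset_inter_left h))

/-- Seven disjoint paths that start on the cuff at height `0`, listed by the angles of their starting
points, mark an essential cycle. -/
theorem GraphEmbedding.exists_isMarkedBy (D : GraphEmbedding G Cylinder) {u : V} (C : G.Walk u u)
    (hC : C.IsCycle) (hturn : Cylinder.turn (D.curve C) = 2 * Real.pi ∨
      Cylinder.turn (D.curve C) = - (2 * Real.pi)) (s t : Fin 7 → V)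
    (P : ∀ i, G.Walk (s i) (t i)) (hP : ∀ i, (P i).IsPath) (hst : ∀ i, s i ≠ t i)
    (hPP : ∀ i i', i ≠ i' → (P i).support.Disjoint (P i').support)
    (hs : ∀ i, (D.point (s i)).2 = 0) {foot : Fin 7 → V}
    (hfoot : ∀ i, foot i ∈ (P i).support ∧ foot i ∈ C.support)
    (hPC : ∀ i v, v ∈ (P i).support → v ∈ C.support → v = foot i)
    {x : Fin 7 → ℝ} (hx : ∀ i, Circle.exp (x i) = (D.point (s i)).1) (hmono : StrictMono x)
    (hx2 : ∀ i j, x i < x j + 2 * Real.pi) : ∃ c σ, C.IsMarkedBy foot c σ := by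
  have hN : (0 : ℤ) < C.length := by have := hC.three_le_length; omega
  have hpi := Real.pi_pos
  have hbuild : ∀ (c : ℤ → V) (q : Fin 7 → ℤ), C.IsMetricParam c →
      (∀ i, c (q i) ∈ (P i).support) →
      (∀ i l (n : ℤ), x i < x l + n * (2 * Real.pi) → q i < q l + n * C.length) →
      ∃ c σ, C.IsMarkedBy foot c σ := by
    intro c q hc hq hlt
    -- Seven steps of the index make one full turn, so the quotient by 7 counts turns.
    refine ⟨c, fun i => q (residue i) + (i / 7) * C.length, hc, ⟨hN, ?_, ?_⟩, ?_⟩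
    · intro i j hij
      have h := hlt (residue i) (residue j) (j / 7 - i / 7) (by
        rcases (show i / 7 ≤ j / 7 by omega).lt_or_eq with h | h
        · have h1 : (1 : ℝ) ≤ ((j / 7 - i / 7 : ℤ) : ℝ) := by exact_mod_cast (by omega)
          have := hx2 (residue i) (residue j)
          nlinarith
        · rw [h, sub_self, Int.cast_zero, zero_mul, add_zero]
          refine hmono ?_
          simp only [residue, Fin.mk_lt_mk]
          omega)
      simp only
      linarith
    · intro i n
      simp only [residue_add]
      rw [Int.add_mul_ediv_right _ _ (by norm_num)]
      ring
    · intro i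
      rw [hc.periodic]
      exact hPC _ _ (hq _) ((hc.mem_iff _).2 ⟨_, rfl⟩)
  -- A cycle of negative turn is reversed. Thus all cycles are run through in the direction of
  -- increasing angle, and the feet appear in the same order on each.
  rcases hturn with hturn | hturn
  · obtain ⟨q, hq, hlt⟩ := D.exists_positions C hC hturn s t P hP hst hPP hs
      (fun i => ⟨foot i, hfoot i, fun v hv => hPC i v hv.1 hv.2⟩) x hx
    exact hbuild _ q hC.isMetricParam hq hlt
  · obtain ⟨q, hq, hlt⟩ := D.exists_positions C.reverse hC.reverse
      (by rw [D.turn_curve_reverse, hturn, neg_neg]) s t P hP hst hPP hs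
      (fun i => ⟨foot i, by simpa using hfoot i, fun v hv => hPC i v hv.1 (by simpa using hv.2)⟩) x hx
    rw [SimpleGraph.Walk.length_reverse] at hlt
    exact hbuild _ q hC.isMetricParam_reverse hq hlt

end Reduction

/-! ### The theorem for any number of paths. -/

theorem theorem16 {V : Type*} [Finite V] [DecidableEq V] (G : SimpleGraph V)
    (D : GraphEmbedding G Cylinder)
    {c₁ c₂ c₃ : V} (C₁ : G.Walk c₁ c₁) (C₂ : G.Walk c₂ c₂) (C₃ : G.Walk c₃ c₃)
    (hC₁ : C₁.IsCycle) (hC₂ : C₂.IsCycle) (hC₃ : C₃.IsCycle)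
    (hC₁₂ : C₁.support.Disjoint C₂.support) (hC₁₃ : C₁.support.Disjoint C₃.support)
    (hC₂₃ : C₂.support.Disjoint C₃.support)
    (hom₁₂ : D.HomotopicCycles C₁ C₂) (hom₁₃ : D.HomotopicCycles C₁ C₃)
    (hom₂₃ : D.HomotopicCycles C₂ C₃)
    (hcuff₁ : Set.range (D.curve C₁) = Cylinder.cuff 0)
    (hcuff₃ : Set.range (D.curve C₃) = Cylinder.cuff 1)
    (k : ℕ) (hk : 7 ≤ k)
    (s t : Fin k → V) (P : ∀ i, G.Walk (s i) (t i)) (hP : ∀ i, (P i).IsPath)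
    (hPP : ∀ i i', i ≠ i' → (P i).support.Disjoint (P i').support)
    (hs : ∀ i, s i ∈ C₁.support) (ht : ∀ i, t i ∈ C₃.support)
    (hPC₁ : ∀ i, ∃! v, v ∈ (P i).support ∧ v ∈ C₁.support)
    (hPC₂ : ∀ i, ∃! v, v ∈ (P i).support ∧ v ∈ C₂.support)
    (hPC₃ : ∀ i, ∃! v, v ∈ (P i).support ∧ v ∈ C₃.support)
    (S T : Finset V) (hS : S = Finset.univ.image s) (hT : T = Finset.univ.image t)
    (a₁ a₂ b₁ b₂ : V) (ha₁ : a₁ ∈ C₁.support) (ha₂ : a₂ ∈ C₁.support)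
    (hb₁ : b₁ ∈ C₃.support) (hb₂ : b₂ ∈ C₃.support) (hb : b₁ ≠ b₂)
    (ha : 2 ≤ cycleDist C₁ S a₁ a₂ ha₁ ha₂) :
    (1 ≤ cycleDist C₃ T b₁ b₂ hb₁ hb₂ →
      (SimpleGraph.completeGraph (Fin 6)).IsMinorOf
        (G ⊔ SimpleGraph.edge a₁ b₁ ⊔ SimpleGraph.edge a₂ b₂)) ∧
    (cycleDist C₃ T b₁ b₂ hb₁ hb₂ = 0 →
      ∀ (a₃ b₃ : V) (_ : a₃ ∈ C₁.support) (hb₃ : b₃ ∈ C₃.support),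
        (1 ≤ cycleDist C₃ T b₁ b₃ hb₁ hb₃ ∨ 1 ≤ cycleDist C₃ T b₂ b₃ hb₂ hb₃) →
        (SimpleGraph.completeGraph (Fin 6)).IsMinorOf
          (G ⊔ SimpleGraph.edge a₁ b₁ ⊔ SimpleGraph.edge a₂ b₂ ⊔ SimpleGraph.edge a₃ b₃)) := by
  subst hS hT
  have hP₁ : ∀ i v, v ∈ (P i).support → v ∈ C₁.support → v = s i := fun i v hv hv' =>
    (hPC₁ i).unique ⟨hv, hv'⟩ ⟨(P i).start_mem_support, hs i⟩
  have hP₃ : ∀ i v, v ∈ (P i).support → v ∈ C₃.support → v = t i := fun i v hv hv' =>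
    (hPC₃ i).unique ⟨hv, hv'⟩ ⟨(P i).end_mem_support, ht i⟩
  choose m hm hmu using hPC₂
  have hst : ∀ i, s i ≠ t i := fun i e => hC₁₃ (hs i) (e ▸ ht i)
  have hs0 : ∀ i, (D.point (s i)).2 = 0 := fun i => by
    have := D.point_mem_range_curve C₁ (hs i)
    rw [hcuff₁] at this
    exact this
  have turn₁ := D.turn_curve_of_range_eq_cuff C₁ hC₁ hcuff₁
  have turn₂ := D.turn_curve_of_homotopicCycles hom₁₂ turn₁
  have turn₃ := D.turn_curve_of_homotopicCycles hom₁₃ turn₁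
  set x : Fin k → ℝ := fun i => Complex.arg (D.point (s i)).1 with hx
  have hxe : ∀ i, Circle.exp (x i) = (D.point (s i)).1 := fun i => Circle.exp_arg _
  have hxinj : Function.Injective x := by
    intro i j hij
    have h1 : (D.point (s i)).1 = (D.point (s j)).1 := by rw [← hxe, ← hxe, hij]
    have h2 : s i = s j := D.point_injective (Prod.ext h1 (by rw [hs0, hs0]))
    by_contra hne
    exact hPP i j hne (P i).start_mem_support 
      ((show ∀ v, v = s j → v ∈ (P j).support by
        rintro _ rfl; exact (P j).start_mem_support) _ h2)
  have hx2 : ∀ i j, x i < x j + 2 * Real.pi := fun i j => by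
    have h1 := Complex.arg_le_pi (D.point (s i)).1
    have h2 := Complex.neg_pi_lt_arg (D.point (s j)).1
    simp only [hx]
    linarith
  obtain ⟨I, hI, hIa⟩ := exists_index_of_le_cycleDist ha
  -- At most four paths witness the distance of `a₁` and `a₂`, two in each segment, and at most two
  -- more, in `J`, a distance on `C₃`: six in all, so seven paths can contain them. The conclusion
  -- left open is that of `isMinorOf_of_markedCycles` for the chosen paths.
  have core : ∀ J : Finset (Fin k), J.card ≤ 2 → ∃ e : Fin 7 → Fin k,
      (∀ i ∈ J, ∃ j, e j = i) ∧ _ := fun J hJ => by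
    obtain ⟨e, he, heIJ⟩ := exists_strictMono_seven hk hxinj (I := I ∪ J)
      ((Finset.card_union_le _ _).trans (by omega))
    have hinj : Function.Injective e := he.injective.of_comp
    have mark := fun {u : V} (C : G.Walk u u) (hC : C.IsCycle) hturn {foot : Fin 7 → V} hfoot hPC =>
      D.exists_isMarkedBy C hC hturn (s ∘ e) (t ∘ e) (fun i => P (e i)) (fun i => hP _)
      (fun i => hst _) (fun i j hij => hPP _ _ (hinj.ne hij)) (fun i => hs0 _) (foot := foot) hfoot
      hPC (x := x ∘ e) (fun i => hxe _) he (fun i j => hx2 _ _)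
    obtain ⟨d₁, σ₁, h₁⟩ := mark C₁ hC₁ turn₁ (foot := s ∘ e)
      (fun i => ⟨(P (e i)).start_mem_support, hs _⟩) (fun i v => hP₁ _ v)
    obtain ⟨d₂, σ₂, h₂⟩ := mark C₂ hC₂ turn₂ (foot := m ∘ e)
      (fun i => hm _) (fun i v hv hv' => hmu _ v ⟨hv, hv'⟩)
    obtain ⟨d₃, σ₃, h₃⟩ := mark C₃ hC₃ turn₃ (foot := t ∘ e)
      (fun i => ⟨(P (e i)).end_mem_support, ht _⟩) (fun i v => hP₃ _ v)
    exact ⟨e, fun i hi => heIJ i (Finset.mem_union_right _ hi),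
      isMinorOf_of_markedCycles h₁ h₂ h₃ hC₁₂ hC₁₃ hC₂₃ (fun i => P (e i)) (fun i => hP _)
      (fun i j hij => hPP _ _ (hinj.ne hij)) (fun i v => hP₁ _ v)
      (fun i v hv hv' => hmu _ v ⟨hv, hv'⟩) (fun i v => hP₃ _ v) (fun i => (hm _).1)
      ha₁ ha₂ hb₁ hb₂ hb (hIa e fun i hi => heIJ i (Finset.mem_union_left _ hi))⟩
  have hne : ∀ {a b : V}, a ∈ C₁.support → b ∈ C₃.support → a ≠ b := fun h h' e =>
    hC₁₃ h (e ▸ h')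
  have hedge : ∀ {a b : V}, a ∈ C₁.support → b ∈ C₃.support → (SimpleGraph.edge a b).Adj a b :=
    fun h h' => (SimpleGraph.edge_adj _ _ _ _).2 ⟨.inl ⟨rfl, rfl⟩, hne h h'⟩
  constructor
  · intro hd
    obtain ⟨J, hJ, hJd⟩ := exists_index_of_le_cycleDist hd
    obtain ⟨e, he, h⟩ := core J hJ
    exact h.1 (hJd e he) _ (le_sup_left.trans le_sup_left) (.inl (.inr (hedge ha₁ hb₁)))
      (.inr (hedge ha₂ hb₂))
  · intro hd a₃ b₃ ha₃ hb₃ hfar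
    obtain ⟨J, hJ, hJd⟩ : ∃ J : Finset (Fin k), J.card ≤ 2 ∧ ∀ e : Fin 7 → Fin k,
        (∀ i ∈ J, ∃ j, e j = i) →
        1 ≤ cycleDist C₃ (Finset.univ.image (t ∘ e)) b₁ b₃ hb₁ hb₃ ∨
        1 ≤ cycleDist C₃ (Finset.univ.image (t ∘ e)) b₂ b₃ hb₂ hb₃ := by
      rcases hfar with hfar | hfar
      · obtain ⟨J, hJ, hJd⟩ := exists_index_of_le_cycleDist hfar
        exact ⟨J, hJ, fun e he => .inl (hJd e he)⟩
      · obtain ⟨J, hJ, hJd⟩ := exists_index_of_le_cycleDist hfar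
        exact ⟨J, hJ, fun e he => .inr (hJd e he)⟩
    obtain ⟨e, he, h⟩ := core J hJ
    -- Dropping paths can only lower a distance, so distance 0 needs no witnesses.
    have hsub : Finset.univ.image (t ∘ e) ⊆ Finset.univ.image t := by
      intro v hv
      obtain ⟨i, -, rfl⟩ := Finset.mem_image.1 hv
      exact Finset.mem_image_of_mem t (Finset.mem_univ _)
    exact h.2 (Nat.le_zero.1 ((cycleDist_mono hsub hb₁ hb₂).trans hd.le)) a₃ b₃ ha₃ hb₃ (hJd e he) _
      ((le_sup_left.trans le_sup_left).trans le_sup_left)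
      (.inl (.inl (.inr (hedge ha₁ hb₁)))) (.inl (.inr (hedge ha₂ hb₂))) (.inr (hedge ha₃ hb₃))
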